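/- Let $p$ be an odd prime, $k=\overline{\mathbb F}_p$, $h\ge 1$, and let $R(X)=\sum_{i=0}^{h}a_iX^{p^i}\in k[X]$ with $a_h\neq 0$. Let $C_R$ be the smooth projective curve over $k$ with affine equation $Y^p-Y=XR(X)$, let $\infty$ be its unique point outside this affine curve, let $\operatorname{Aut}^0(C_R)$ be the group of $k$-automorphisms of $C_R$ that fix $\infty$, and let $P$ be the Sylow $p$-subgroup of $\operatorname{Aut}^0(C_R)$. Let $$E(X)=R(X)^{p^h}+\sum_{i=0}^{h}(a_iX)^{p^{h-i}},\qquad W=\{c\in k: E(c)=0\},$$ an $\mathbb F_p$-vector space. Let $E(p^3)=\langle u,v\mid u^p=v^p=[u,v]^p=1,\ [u,v]\text{ central}\rangle$, where $[\sigma,\tau]=\sigma\tau\sigma^{-1}\tau^{-1}$. Then $E(p^3)$ is nonabelian of order $p^3$ and exponent $p$, and $P$ is a central product of $h$ copies of $E(p^3)$: it is isomorphic to the quotient of $E(p^3)^h$ by the subgroup of all $(z_1,\dots,z_h)\in Z(E(p^3))^h$ with $z_1\cdots z_h=1$, that is, with the centers of the copies identified. The decomposition comes from a symplectic basis of $W$,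 as follows. 1. For every $c\in W$ there is a unique polynomial $B_c\in Xk[X]$ with $B_c(X)^p-B_c(X)=cR(X)+R(c)X$. The formula $\epsilon(c_1,c_2)=B_{c_1}(c_2)-B_{c_2}(c_1)$ defines a nondegenerate alternating $\mathbb F_p$-bilinear form $\epsilon:W\times W\to\mathbb F_p$. 2. There is a surjective homomorphism $\pi:P\to W$ with kernel $Z(P)$ such that every $\sigma\in P$ acts on the coordinate $x$ by $x\mapsto x+\pi(\sigma)$. For all $\sigma,\tau\in P$ the commutator $[\sigma,\tau]$ is the automorphism $(x,y)\mapsto(x,\,y+\epsilon(\pi(\sigma),\pi(\tau)))$. 3. There is a basis $c_1,\dots,c_h,c_1',\dots,c_h'$ of $W$ with $\epsilon(c_i,c_j)=\epsilon(c_i',c_j')=0$ and $\epsilon(c_i,c_j')=\delta_{i,j}$ for all $i,j$. For every such basis and all $\sigma_i,\sigma_i'\in P$ with $\pi(\sigma_i)=c_i$ and $\pi(\sigma_i')=c_i'$, each subgroup $E_i=\langle\sigma_i,\sigma_i'\rangle$ is isomorphic to $E(p^3)$, and $P$ is the central product of $E_1,\dots,E_h$: these subgroups generate $P$, elements of $E_i$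 and $E_j$ commute for $i\ne j$, and $Z(E_i)=Z(P)$ for all $i$. Moreover the isomorphism from the quotient of $E(p^3)^h$ above to $P$ can be chosen so that it sends the generators $u,v$ of the $i$-th copy to $\sigma_i,\sigma_i'$ for all $i$. -/

import Mathlib

open Polynomial
open scoped Pointwise commutatorElement

/-- An additive polynomial `R = ∑_{i ≤ h} a_i X^(p^i)` of degree exactly `p^h` over `k`. -/
structure AdditivePoly (p : ℕ) (k : Type*) [Field k] (h : ℕ) where
  /-- the coefficients `a_0, …, a_h` -/
  a : Fin (h + 1) → k
  lead_ne_zero : a (Fin.last h) ≠ 0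

namespace AdditivePoly

variable {p : ℕ} {k : Type*} [Field k] {h : ℕ}

/-- `R(X) = ∑ a_i X^(p^i)` as a polynomial. -/
noncomputable def toPoly (R : AdditivePoly p k h) : k[X] :=
  ∑ i : Fin (h + 1), C (R.a i) * X ^ (p ^ (i : ℕ))

/-- `E(X) = R(X)^(p^h) + ∑ (a_i X)^(p^(h-i))`. -/
noncomputable def E (R : AdditivePoly p k h) : k[X] :=
  R.toPoly ^ (p ^ h) + ∑ i : Fin (h + 1), (C (R.a i) * X) ^ (p ^ (h - (i : ℕ)))

/-- `B` has zero constant term and `B^p - B = c R(X) + R(c) X`. -/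
def IsB (R : AdditivePoly p k h) (c : k) (B : k[X]) : Prop :=
  X ∣ B ∧ B ^ p - B = C c * R.toPoly + C (R.toPoly.eval c) * X

open Classical in
/-- The polynomial `B_c(X)`: the solution of `B^p - B = c R(X) + R(c) X` without constant term
(and `0` if there is none). -/
noncomputable def B (R : AdditivePoly p k h) (c : k) : k[X] :=
  if hc : ∃ B, R.IsB c B then hc.choose else 0

/-! ### The space `W` of zeros of `E` -/

section W

variable [Fact p.Prime] [Algebra (ZMod p) k]

/-- The zero locus of `E` in `k`, as an `𝔽_p`-subspace. -/
noncomputable def W (R : AdditivePoly p k h) : Submodule (ZMod p) k :=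
  AddSubgroup.toZModSubmodule p
    { carrier := {c : k | R.E.eval c = 0}
      zero_mem' := by
        have hp := (Fact.out : p.Prime).ne_zero
        simp [E, toPoly, eval_finsetSum, hp]
      add_mem' := by
        have : CharP k p := charP_of_injective_algebraMap (algebraMap (ZMod p) k).injective p
        intro c d hc hd
        simp only [Set.mem_ofPred_eq, E, toPoly, eval_add, eval_pow, eval_finsetSum, eval_mul,
          eval_C, eval_X] at hc hd ⊢
        simp only [mul_add, add_pow_char_pow, Finset.sum_add_distrib] at hc hd ⊢
        linear_combination hc + hd
      neg_mem' := by
        have : CharP k p := charP_of_injective_algebraMap (algebraMap (ZMod p) k).injective p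
        intro c hc
        have key : ∀ n : ℕ, ∀ x : k, (-x) ^ p ^ n = -(x ^ p ^ n) := fun n x => by
          have := sub_pow_char_pow (R := k) (p := p) (n := n) 0 x
          simpa [(Fact.out : p.Prime).ne_zero] using this
        simp only [Set.mem_ofPred_eq, E, toPoly, eval_add, eval_pow, eval_finsetSum, eval_mul,
          eval_C, eval_X] at hc ⊢
        simp only [mul_neg, key, Finset.sum_neg_distrib] at hc ⊢
        linear_combination -hc }

end W

/-! ### The function field of the curve `Y^p - Y = X R(X)` -/

/-- The polynomial `Y^p - Y - x R(x)` over the rational function field `k(x)`. -/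
noncomputable def artinSchreier (R : AdditivePoly p k h) : (RatFunc k)[X] :=
  X ^ p - X - C (algebraMap k[X] (RatFunc k) (X * R.toPoly))

lemma irreducible_of_no_root {F : Type*} [Field F] [Fact p.Prime] [CharP F p] (c : F)
    (hc : ∀ z : F, z ^ p - z ≠ c) : Irreducible (X ^ p - X - C c : F[X]) := by
  have hp1 : 1 < p := (Fact.out : p.Prime).one_lt
  set f : F[X] := X ^ p - X - C c with hf
  have hlt : (X + C c : F[X]).natDegree < (X ^ p : F[X]).natDegree := by
    rw [natDegree_X_add_C, natDegree_X_pow]; exact hp1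
  have hdeg : f.natDegree = p := by
    rw [hf, sub_sub, natDegree_sub_eq_left_of_natDegree_lt hlt, natDegree_X_pow]
  have hf0 : f ≠ 0 := fun h0 => by rw [h0, natDegree_zero] at hdeg; omega
  have hq := irreducible_factor f
  have hqf : factor f ∣ f := factor_dvd_of_natDegree_ne_zero (by omega)
  suffices hle : p ≤ (factor f).natDegree from
    (associated_of_dvd_of_natDegree_le hqf hf0 (by rw [hdeg]; exact hle)).irreducible hq
  by_contra hlt'
  rw [not_le] at hlt'
  set q : F[X] := factor f * C (factor f).leadingCoeff⁻¹ with hqdef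
  have hqm : q.Monic := monic_mul_leadingCoeff_inv hq.ne_zero
  have hqd : q.natDegree = (factor f).natDegree :=
    natDegree_mul_leadingCoeff_self_inv _
  have hqpos : 0 < q.natDegree := hqd ▸ hq.natDegree_pos
  have hqf' : q ∣ f := by
    refine dvd_trans ?_ hqf
    have hu : IsUnit (C (factor f).leadingCoeff⁻¹) :=
      isUnit_C.2 (IsUnit.mk0 _ (inv_ne_zero (leadingCoeff_ne_zero.2 hq.ne_zero)))
    exact (hu.mul_right_dvd).2 dvd_rfl
  let L := SplittingField q
  have : CharP L p := charP_of_injective_algebraMap (algebraMap F L).injective p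
  have hs : (q.map (algebraMap F L)).Splits := SplittingField.splits q
  have hm : (q.map (algebraMap F L)).Monic := hqm.map _
  have hroot : ∀ β ∈ (q.map (algebraMap F L)).roots, β ^ p - β = algebraMap F L c := by
    intro β hβ
    have h1 : (f.map (algebraMap F L)).eval β = 0 :=
      eval_eq_zero_of_dvd_of_eval_eq_zero (Polynomial.map_dvd _ hqf') (isRoot_of_mem_roots hβ)
    simp only [hf, Polynomial.map_sub, Polynomial.map_pow, map_X, map_C, eval_sub, eval_pow, eval_X,
      eval_C] at h1
    exact sub_eq_zero.1 h1
  have hcard : (q.map (algebraMap F L)).roots.card = q.natDegree := by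
    rw [← hs.natDegree_eq_card_roots, hqm.natDegree_map]
  obtain ⟨α, hα⟩ := Multiset.card_pos_iff_exists_mem.1 (hcard ▸ hqpos)
  have hmem : ∀ β ∈ (q.map (algebraMap F L)).roots, β - α ∈ (algebraMap F L).fieldRange := by
    intro β hβ
    have h1 : (β - α) ^ p = β - α := by
      rw [sub_pow_char]
      linear_combination hroot β hβ - hroot α hα
    exact (bot_le : (⊥ : Subfield L) ≤ _) ((Subfield.mem_bot_iff_pow_eq_self L p).2 h1)
  have hsum : ∀ s : Multiset L, (∀ β ∈ s, β - α ∈ (algebraMap F L).fieldRange) →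
      s.sum - s.card * α ∈ (algebraMap F L).fieldRange := by
    intro s
    induction s using Multiset.induction with
    | empty => intro _; simp
    | cons a s ih =>
      intro H
      have h1 := ih fun β hβ => H β (Multiset.mem_cons_of_mem hβ)
      have h2 := H a (Multiset.mem_cons_self a s)
      have h3 := add_mem h1 h2
      convert h3 using 1
      simp only [Multiset.sum_cons, Multiset.card_cons, Nat.cast_add, Nat.cast_one]
      ring
  have h1 := hsum _ hmem
  have h2 : (q.map (algebraMap F L)).roots.sum ∈ (algebraMap F L).fieldRange := by
    have := hs.nextCoeff_eq_neg_sum_roots_of_monic hm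
    rw [nextCoeff_map (algebraMap F L).injective] at this
    exact ⟨-q.nextCoeff, by rw [map_neg, this, neg_neg]⟩
  have h3 : (q.natDegree : L) * α ∈ (algebraMap F L).fieldRange := by
    have := sub_mem h2 h1
    rwa [sub_sub_cancel, hcard] at this
  have hne : (q.natDegree : L) ≠ 0 := by
    rw [Ne, CharP.cast_eq_zero_iff L p]
    exact Nat.not_dvd_of_pos_of_lt hqpos (hqd ▸ hlt')
  have h4 : α ∈ (algebraMap F L).fieldRange := by
    have := mul_mem (inv_mem (natCast_mem (algebraMap F L).fieldRange q.natDegree)) h3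
    rwa [inv_mul_cancel_left₀ hne] at this
  obtain ⟨z, hz⟩ := h4
  refine hc z ((algebraMap F L).injective ?_)
  rw [map_sub, map_pow, hz]
  exact hroot α hα

lemma natDegree_X_mul_toPoly (R : AdditivePoly p k h) (hp : 1 < p) :
    (X * R.toPoly).natDegree = p ^ h + 1 := by
  have h1 : R.toPoly.natDegree = p ^ h := by
    rw [toPoly, Fin.sum_univ_castSucc, natDegree_add_eq_right_of_natDegree_lt]
    · simpa using natDegree_C_mul_X_pow _ _ R.lead_ne_zero
    · rw [Fin.val_last, natDegree_C_mul_X_pow _ _ R.lead_ne_zero]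
      refine lt_of_le_of_lt (natDegree_sum_le_of_forall_le (n := p ^ h - 1) _ _ fun i _ => ?_)
        (Nat.sub_lt (pow_pos (by omega) _) one_pos)
      refine (natDegree_C_mul_X_pow_le _ _).trans ?_
      have := Nat.pow_lt_pow_right hp i.2
      simp only [Fin.val_castSucc]
      omega
  have h0 : R.toPoly ≠ 0 := fun h0 => by
    rw [h0, natDegree_zero] at h1
    exact (pow_pos (by omega : 0 < p) h).ne h1
  rw [natDegree_X_mul h0, h1]

lemma no_root (R : AdditivePoly p k h) [Fact p.Prime] (hp : p ≠ 2) (z : RatFunc k) :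
    z ^ p - z ≠ algebraMap k[X] (RatFunc k) (X * R.toPoly) := by
  have hpp : p.Prime := Fact.out
  intro hz
  have hint : IsIntegral k[X] z := by
    refine ⟨X ^ p - (X + C (X * R.toPoly)), ?_, ?_⟩
    · refine monic_X_pow_sub ?_
      rw [degree_X_add_C]
      exact_mod_cast hpp.one_lt
    · simp only [eval₂_sub, eval₂_add, eval₂_X_pow, eval₂_X, eval₂_C]
      linear_combination hz
  obtain ⟨g, rfl⟩ := IsIntegrallyClosed.isIntegral_iff.1 hint
  rw [← map_pow, ← map_sub] at hz
  have hg := congrArg natDegree (IsFractionRing.injective k[X] (RatFunc k) hz)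
  rw [R.natDegree_X_mul_toPoly hpp.one_lt] at hg
  have hpow : 0 < p ^ h := pow_pos hpp.pos h
  rcases Nat.eq_zero_or_pos g.natDegree with h0 | h0
  · have h1 : (g ^ p - g).natDegree ≤ 0 := by
      refine (natDegree_sub_le _ _).trans ?_
      simp [h0]
    omega
  · have h1 : (g ^ p - g).natDegree = p * g.natDegree := by
      rw [natDegree_sub_eq_left_of_natDegree_lt, natDegree_pow]
      rw [natDegree_pow]
      exact lt_mul_of_one_lt_left h0 hpp.one_lt
    rw [h1] at hg
    have hdvd : p ∣ p ^ h + 1 := ⟨_, hg.symm⟩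
    rcases Nat.eq_zero_or_pos h with rfl | hh
    · have := Nat.le_of_dvd two_pos (by simpa using hdvd)
      have := hpp.two_le
      omega
    · have := (Nat.dvd_add_right (dvd_pow_self p hh.ne')).1 hdvd
      exact hpp.one_lt.ne' (Nat.dvd_one.1 this)

instance irreducible_artinSchreier (R : AdditivePoly p k h) [Fact p.Prime] [Fact (p ≠ 2)]
    [Algebra (ZMod p) k] : Fact (Irreducible R.artinSchreier) := by
  have : CharP k p := charP_of_injective_algebraMap (algebraMap (ZMod p) k).injective p
  have : CharP (RatFunc k) p :=
    charP_of_injective_algebraMap (algebraMap k (RatFunc k)).injective p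
  exact ⟨irreducible_of_no_root _ (R.no_root Fact.out)⟩

/-- The function field `k(x, y)`, `y^p - y = x R(x)`, of the smooth projective curve `C_R`. -/
abbrev FunctionField (R : AdditivePoly p k h) : Type _ := AdjoinRoot R.artinSchreier

/-- The coordinate function `x` on `C_R`. -/
noncomputable def x (R : AdditivePoly p k h) : R.FunctionField :=
  AdjoinRoot.of R.artinSchreier RatFunc.X

/-- The coordinate function `y` on `C_R`. -/
noncomputable def y (R : AdditivePoly p k h) : R.FunctionField :=
  AdjoinRoot.root R.artinSchreier

/-- The group of `k`-automorphisms of the smooth projective curve `C_R`. An automorphism `σ` is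
given by its pullback `f ↦ f ∘ σ` on functions; pullback reverses composition, so this is the
opposite of the group of `k`-automorphisms of the function field. -/
abbrev CurveAut (R : AdditivePoly p k h) : Type _ :=
  (R.FunctionField ≃ₐ[k] R.FunctionField)ᵐᵒᵖ

/-- The pullback of functions along an automorphism of `C_R`. -/
noncomputable def pullback {R : AdditivePoly p k h} (σ : R.CurveAut) : R.FunctionField ≃ₐ[k] R.FunctionField :=
  σ.unop

section Aut

variable [Fact p.Prime] [Fact (p ≠ 2)] [Algebra (ZMod p) k]

/-- Points of `C_R` are valuation rings `O` of its function field with `k ⊆ O ≠ k(x, y)`. This says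
that `O` is a point outside the affine curve `y^p - y = x R(x)`, i.e. that `x` or `y` has a
pole there. There is exactly one such point, denoted `∞`. -/
def IsAtInfinity (R : AdditivePoly p k h) (O : ValuationSubring R.FunctionField) : Prop :=
  (∀ t : k, algebraMap k R.FunctionField t ∈ O) ∧ (R.x ∉ O ∨ R.y ∉ O)

/-- `Aut⁰(C_R)`: the automorphisms of `C_R` fixing the point at infinity. -/
noncomputable def Aut0 (R : AdditivePoly p k h) : Subgroup R.CurveAut :=
  ⨅ (O : ValuationSubring R.FunctionField) (_ : R.IsAtInfinity O),
    (MulAction.stabilizer (R.FunctionField ≃ₐ[k] R.FunctionField) O).op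

end Aut

end AdditivePoly

/-! ### The group `E(p³)` and central products -/

/-- The relations `u^p = v^p = [u,v]^p = 1` and `[u,v]` central, on the generators
`u = of false` and `v = of true`. -/
def extraspecialRels (p : ℕ) : Set (FreeGroup Bool) :=
  let u := FreeGroup.of false
  let v := FreeGroup.of true
  {u ^ p, v ^ p, ⁅u, v⁆ ^ p, ⁅⁅u, v⁆, u⁆, ⁅⁅u, v⁆, v⁆}

/-- `E(p³) = ⟨u, v ∣ u^p = v^p = [u,v]^p = 1, [u,v] central⟩`. -/
abbrev ExtraspecialP3 (p : ℕ) : Type := PresentedGroup (extraspecialRels p)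

/-- The first generator of `E(p³)`. -/
def ExtraspecialP3.u (p : ℕ) : ExtraspecialP3 p := PresentedGroup.of false

/-- The second generator of `E(p³)`. -/
def ExtraspecialP3.v (p : ℕ) : ExtraspecialP3 p := PresentedGroup.of true

open scoped IsMulCommutative in
/-- In the direct power `G^ι`, the subgroup of all families of central elements with product `1`. -/
def centralKernel (ι G : Type*) [Fintype ι] [Group G] : Subgroup (ι → G) where
  carrier := {z | ∃ w : ι → Subgroup.center G, (∀ i, z i = w i) ∧ ∏ i, w i = 1}
  one_mem' := ⟨1, by simp, by simp⟩
  mul_mem' := by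
    rintro z z' ⟨w, hw, hw1⟩ ⟨w', hw', hw1'⟩
    exact ⟨w * w', by simp [hw, hw'], by simp [Finset.prod_mul_distrib, hw1, hw1']⟩
  inv_mem' := by
    rintro z ⟨w, hw, hw1⟩
    exact ⟨w⁻¹, by simp [hw], by simp [hw1]⟩

open scoped IsMulCommutative in
instance centralKernel_normal (ι G : Type*) [Fintype ι] [Group G] :
    (centralKernel ι G).Normal where
  conj_mem := by
    rintro z ⟨w, hw, hw1⟩ g
    refine ⟨w, fun i => ?_, hw1⟩
    have := Subgroup.mem_center_iff.1 (w i).2 (g i)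
    simp [hw, this]

/-- The external central product of copies of `G` indexed by `ι`: the quotient of the direct power
`G^ι` in which the centres of all the copies are identified with each other. -/
abbrev CentralPower (ι G : Type*) [Fintype ι] [Group G] : Type _ := (ι → G) ⧸ centralKernel ι G

/-- The image in the central product of an element of the `i`-th copy of `G`. -/
def CentralPower.single {ι G : Type*} [Fintype ι] [DecidableEq ι] [Group G] (i : ι) (g : G) :
    CentralPower ι G :=
  QuotientGroup.mk (Pi.mulSingle i g)

/-- `G` is the internal central product of its subgroups `H i`: they generate `G`, they commute
elementwise, and their centres are all equal to the centre of `G`. -/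
structure IsCentralProduct {ι G : Type*} [Group G] (H : ι → Subgroup G) : Prop where
  iSup_eq_top : ⨆ i, H i = ⊤
  commute : ∀ i j, i ≠ j → ∀ g ∈ H i, ∀ g' ∈ H j, Commute g g'
  center_eq : ∀ i, (Subgroup.center (H i)).map (H i).subtype = Subgroup.center G

/-- `c_1, …, c_h, c'_1, …, c'_h` (the left and the right half of the basis) is a symplectic basis
for the bilinear form `ε`. -/
def IsSymplecticBasis {F V ι : Type*} [CommRing F] [AddCommGroup V] [Module F V] [DecidableEq ι]
    (ε : LinearMap.BilinForm F V) (b : Module.Basis (ι ⊕ ι) F V) : Prop :=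
  ∀ i j, ε (b (.inl i)) (b (.inl j)) = 0 ∧ ε (b (.inr i)) (b (.inr j)) = 0 ∧
    ε (b (.inl i)) (b (.inr j)) = if i = j then 1 else 0

namespace AdditivePoly

variable {p : ℕ} {k : Type*} [Field k] {h : ℕ}

/-! ### The polynomials `B_c` -/

section Polynomials

/-! The elements of `p`-power order in Aut⁰(C_R) are exactly the maps (x, y) ↦ (x + c, y + B_c(x) +
β) with c ∈ W and β^p − β = cR(c). So P is an extension of W by 𝔽_p with cocycle B_c(d), its
commutator form is the antisymmetrization ε, and the rest is the theory of extraspecial groups.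

Polynomials. Solving B^p − B = cR + R(c)X by telescoping leaves the error term E(c)X^(p^h)
(`explicitB_pow_sub`), and no choice of B removes a nonzero error
(`eq_zero_of_pow_sub_self_eq_monomial`); hence W is exactly the set of c for which B_c exists. E is
separable of degree p^(2h), which gives the order of W. For fixed c ≠ 0, the value ε(c, d) is given
on W by a polynomial in d of degree p^(2h−1), too small to vanish on all of W: ε is nondegenerate.

Automorphisms. At infinity x and y have pole orders p and p^h + 1, so the monomials x^m y^i with i <
p have distinct pole orders (`IsAtInfinity.valuation_aeval_y`). Hence there is only one point at
infinity. The ring k[x, y] is integrally closed, its discriminant being a unit, so an automorphism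
fixing infinity maps x and y to polynomials in x and y; pole orders leave x ↦ ax + b, y ↦ dy + B(x).
If the order is a power of p then a = d = 1, and the curve equation forces b ∈ W and B = B_b +
constant. Conversely these maps all exist and, p being odd, form a group of exponent p, which is
therefore the unique Sylow subgroup.

Group theory. Nondegeneracy of ε makes the kernel of P → W the centre. Lifts of a symplectic basis
give pairs with one common commutator (x, y) ↦ (x, y + 1), different pairs commute, and each pair
satisfies the relations of E(p³). The resulting map E(p³)^h → P is surjective, injective on each
factor and the same on all the centres, which determines its kernel (`ker_eq_centralKernel`). -/

lemma IsB.eval_zero {R : AdditivePoly p k h} {c : k} {B : k[X]} (hB : R.IsB c B) :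
    B.eval 0 = 0 := by
  rw [← coeff_zero_eq_eval_zero]
  exact X_dvd_iff.1 hB.1

lemma toPoly_eval (R : AdditivePoly p k h) (c : k) :
    R.toPoly.eval c = ∑ i : Fin (h + 1), R.a i * c ^ p ^ (i : ℕ) := by
  simp [toPoly, eval_finsetSum]

/-- An explicit polynomial which is `B_c` for `c ∈ W`. -/
noncomputable def explicitB (R : AdditivePoly p k h) (c : k) : k[X] :=
  -(∑ j ∈ Finset.range h, (C (R.toPoly.eval c) * X) ^ p ^ j) -
    ∑ i : Fin (h + 1), ∑ j ∈ Finset.range (h - i), (C (c * R.a i) * X ^ p ^ (i : ℕ)) ^ p ^ j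

/-- For fixed `t`, a polynomial in `c` which takes the value `B_c(t)` at each `c ∈ W`. -/
noncomputable def swappedB (R : AdditivePoly p k h) (t : k) : k[X] :=
  -(∑ j ∈ Finset.range h, (C t * R.toPoly) ^ p ^ j) -
    ∑ i : Fin (h + 1), ∑ j ∈ Finset.range (h - i), (C (R.a i * t ^ p ^ (i : ℕ)) * X) ^ p ^ j

lemma swappedB_eval (R : AdditivePoly p k h) (c t : k) :
    (R.swappedB t).eval c = (R.explicitB c).eval t := by
  simp only [swappedB, explicitB, eval_sub, eval_neg, eval_finsetSum, eval_pow, eval_mul, eval_C,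
    eval_X]
  congr 1
  · simp only [mul_comm t]
  · refine Finset.sum_congr rfl fun i _ => Finset.sum_congr rfl fun j _ => ?_
    ring

variable [Fact p.Prime]

/-- Comparing degrees, p · deg D = deg D. This is the source of every uniqueness statement about
B_c. -/
lemma exists_eq_C_of_pow_sub_self_eq_zero {D : k[X]} (hD : D ^ p - D = 0) : ∃ a, D = C a := by
  have h1 := congrArg natDegree (sub_eq_zero.1 hD)
  rw [natDegree_pow] at h1
  have hp := (Fact.out : p.Prime).one_lt
  refine ⟨D.coeff 0, eq_C_of_natDegree_eq_zero ?_⟩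
  by_contra h0
  exact (lt_mul_of_one_lt_left (Nat.pos_of_ne_zero h0) hp).ne' h1

lemma eq_zero_of_pow_sub_self_eq_zero {D : k[X]} (hD : D ^ p - D = 0) {t : k}
    (ht : D.eval t = 0) : D = 0 := by
  obtain ⟨a, rfl⟩ := exists_eq_C_of_pow_sub_self_eq_zero hD
  simpa using ht

lemma toPoly_ne_zero (R : AdditivePoly p k h) : R.toPoly ≠ 0 := by
  intro h0
  have h1 := R.natDegree_X_mul_toPoly (Fact.out : p.Prime).one_lt
  rw [h0] at h1
  simp at h1

lemma toPoly_natDegree (R : AdditivePoly p k h) : R.toPoly.natDegree = p ^ h := by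
  have h1 := R.natDegree_X_mul_toPoly (Fact.out : p.Prime).one_lt
  rw [natDegree_X_mul R.toPoly_ne_zero] at h1
  omega

lemma E_natDegree (R : AdditivePoly p k h) (hh : 1 ≤ h) : R.E.natDegree = p ^ (2 * h) := by
  have hp : p.Prime := Fact.out
  rw [E, natDegree_add_eq_left_of_natDegree_lt, natDegree_pow, toPoly_natDegree]
  · ring
  rw [natDegree_pow, toPoly_natDegree, ← pow_add]
  refine (natDegree_sum_le_of_forall_le (n := p ^ h) _ _ fun i _ => ?_).trans_lt
    (Nat.pow_lt_pow_right hp.one_lt (by omega))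
  refine natDegree_pow_le.trans
    ((Nat.mul_le_mul_left _ ((natDegree_C_mul_le _ _).trans natDegree_X_le)).trans ?_)
  rw [mul_one]
  exact Nat.pow_le_pow_right hp.pos (by omega)

lemma toPoly_eval_zero (R : AdditivePoly p k h) : R.toPoly.eval 0 = 0 := by
  simp [toPoly_eval, (Fact.out : p.Prime).ne_zero]

lemma explicitB_eval_zero (R : AdditivePoly p k h) (c : k) : (R.explicitB c).eval 0 = 0 := by
  simp [explicitB, eval_finsetSum, (Fact.out : p.Prime).ne_zero]

lemma explicitB_natDegree_le (R : AdditivePoly p k h) (c : k) :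
    (R.explicitB c).natDegree ≤ p ^ (h - 1) := by
  have hp : p.Prime := Fact.out
  rw [explicitB]
  refine (natDegree_sub_le _ _).trans (max_le ?_ ?_)
  · rw [natDegree_neg]
    refine natDegree_sum_le_of_forall_le _ _ fun j hj => natDegree_pow_le.trans ?_
    refine (Nat.mul_le_mul_left _ ((natDegree_C_mul_le _ _).trans natDegree_X_le)).trans ?_
    rw [mul_one]
    have := Finset.mem_range.1 hj
    exact Nat.pow_le_pow_right hp.pos (by omega)
  · refine natDegree_sum_le_of_forall_le _ _ fun i _ =>
      natDegree_sum_le_of_forall_le _ _ fun j hj => natDegree_pow_le.trans ?_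
    refine (Nat.mul_le_mul_left _ (natDegree_C_mul_X_pow_le _ _)).trans ?_
    rw [← pow_add]
    have := Finset.mem_range.1 hj
    exact Nat.pow_le_pow_right hp.pos (by omega)

/-- The term (tR)^(p^(h−1)) dominates: R has degree p^h, while the double sum is only of degree at
most p^(h−1) in the new variable. -/
lemma swappedB_natDegree (R : AdditivePoly p k h) (hh : 1 ≤ h) {t : k} (ht : t ≠ 0) :
    (R.swappedB t).natDegree = p ^ (2 * h - 1) := by
  have hp : p.Prime := Fact.out
  have hdeg : ∀ j, ((C t * R.toPoly) ^ p ^ j).natDegree = p ^ (j + h) := fun j => by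
    rw [natDegree_pow, natDegree_C_mul ht, toPoly_natDegree, pow_add]
  have h1 : (∑ j ∈ Finset.range h, (C t * R.toPoly) ^ p ^ j).natDegree = p ^ (2 * h - 1) := by
    obtain ⟨m, rfl⟩ : ∃ m, h = m + 1 := ⟨h - 1, by omega⟩
    rw [Finset.sum_range_succ, natDegree_add_eq_right_of_natDegree_lt, hdeg]
    · congr 1; omega
    · rw [hdeg]
      refine (natDegree_sum_le_of_forall_le (n := p ^ (m + m)) _ _ fun j hj => ?_).trans_lt
        (Nat.pow_lt_pow_right hp.one_lt (by omega))
      rw [hdeg]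
      have := Finset.mem_range.1 hj
      exact Nat.pow_le_pow_right hp.pos (by omega)
  rw [swappedB, natDegree_sub_eq_left_of_natDegree_lt, natDegree_neg, h1]
  rw [natDegree_neg, h1]
  refine (natDegree_sum_le_of_forall_le (n := p ^ (h - 1)) _ _ fun i _ =>
      natDegree_sum_le_of_forall_le _ _ fun j hj => natDegree_pow_le.trans ?_).trans_lt
        (Nat.pow_lt_pow_right hp.one_lt (by omega))
  refine (Nat.mul_le_mul_left _ ((natDegree_C_mul_le _ _).trans natDegree_X_le)).trans ?_
  rw [mul_one]
  have := Finset.mem_range.1 hj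
  exact Nat.pow_le_pow_right hp.pos (by omega)

variable [CharP k p]

lemma toPoly_eval_add (R : AdditivePoly p k h) (c d : k) :
    R.toPoly.eval (c + d) = R.toPoly.eval c + R.toPoly.eval d := by
  simp [toPoly_eval, add_pow_char_pow, mul_add, Finset.sum_add_distrib]

lemma toPoly_comp_X_add_C (R : AdditivePoly p k h) (c : k) :
    R.toPoly.comp (X + C c) = R.toPoly + C (R.toPoly.eval c) := by
  simp [toPoly, eval_finsetSum, Polynomial.sum_comp, add_pow_char_pow, mul_add,
    Finset.sum_add_distrib]

lemma IsB.unique {R : AdditivePoly p k h} {c : k} {B B' : k[X]} (hB : R.IsB c B)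
    (hB' : R.IsB c B') : B = B' := by
  refine sub_eq_zero.1 (eq_zero_of_pow_sub_self_eq_zero (p := p) (t := 0) ?_ ?_)
  · rw [sub_pow_char]
    linear_combination hB.2 - hB'.2
  · rw [eval_sub, hB.eval_zero, hB'.eval_zero, sub_zero]

lemma sum_range_pow_char_pow_sub (f : k[X]) (n : ℕ) :
    (∑ j ∈ Finset.range n, f ^ p ^ j) ^ p - ∑ j ∈ Finset.range n, f ^ p ^ j = f ^ p ^ n - f := by
  rw [sum_pow_char, ← Finset.sum_sub_distrib]
  simp only [← pow_mul, ← pow_succ]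
  rw [Finset.sum_range_sub (fun j => f ^ p ^ j)]
  simp

/-- Under f ↦ f^p − f each sum of iterated p-th powers telescopes to its two ends. The lower ends
give cR + R(c)X; the upper ends are all multiples of X^(p^h), with coefficients adding up to E(c).
So E(c) is the obstruction to solving the equation. -/
lemma explicitB_pow_sub (R : AdditivePoly p k h) (c : k) :
    R.explicitB c ^ p - R.explicitB c =
      C c * R.toPoly + C (R.toPoly.eval c) * X - C (R.E.eval c) * X ^ p ^ h := by
  have hneg : ∀ f : k[X], (-f) ^ p = -f ^ p := fun f => map_neg (frobenius k[X] p) f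
  have h1 := sum_range_pow_char_pow_sub (p := p) (C (R.toPoly.eval c) * X) h
  have h2 : (∑ i : Fin (h + 1), ∑ j ∈ Finset.range (h - i),
        (C (c * R.a i) * X ^ p ^ (i : ℕ)) ^ p ^ j) ^ p -
      ∑ i : Fin (h + 1), ∑ j ∈ Finset.range (h - i), (C (c * R.a i) * X ^ p ^ (i : ℕ)) ^ p ^ j =
      ∑ i : Fin (h + 1), (C (R.a i * c) ^ p ^ (h - i : ℕ) * X ^ p ^ h -
        C c * (C (R.a i) * X ^ p ^ (i : ℕ))) := by
    rw [sum_pow_char, ← Finset.sum_sub_distrib]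
    refine Finset.sum_congr rfl fun i _ => ?_
    rw [sum_range_pow_char_pow_sub, mul_pow, ← pow_mul, ← pow_add,
      Nat.add_sub_cancel' (Nat.le_of_lt_succ i.2), mul_comm c, C_mul]
    ring
  have h3 : C (R.E.eval c) = C (R.toPoly.eval c) ^ p ^ h +
      ∑ i : Fin (h + 1), C (R.a i * c) ^ p ^ (h - i : ℕ) := by
    simp [E, eval_finsetSum]
  rw [Finset.sum_sub_distrib, ← Finset.mul_sum, ← Finset.sum_mul] at h2
  have h4 : C c * R.toPoly = C c * ∑ i : Fin (h + 1), C (R.a i) * X ^ p ^ (i : ℕ) := rfl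
  rw [explicitB, sub_pow_char, hneg, h3, h4]
  rw [mul_pow] at h1
  linear_combination -h1 - h2

lemma isB_explicitB (R : AdditivePoly p k h) {c : k} (hc : R.E.eval c = 0) :
    R.IsB c (R.explicitB c) := by
  refine ⟨X_dvd_iff.2 ?_, ?_⟩
  · rw [coeff_zero_eq_eval_zero, explicitB_eval_zero]
  · rw [explicitB_pow_sub, hc]; simp

lemma isB_B (R : AdditivePoly p k h) {c : k} (hc : R.E.eval c = 0) : R.IsB c (R.B c) := by
  have : ∃ B, R.IsB c B := ⟨_, R.isB_explicitB hc⟩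
  rw [B, dif_pos this]
  exact this.choose_spec

lemma B_eq_explicitB (R : AdditivePoly p k h) {c : k} (hc : R.E.eval c = 0) :
    R.B c = R.explicitB c :=
  (R.isB_B hc).unique (R.isB_explicitB hc)

/-- Follow the coefficients of D at X^(p^m): they vanish for m < n, equal −γ at m = n, and
afterwards each is the p-th power of the preceding one. Since D has only finitely many nonzero
coefficients, γ = 0. -/
lemma eq_zero_of_pow_sub_self_eq_monomial {D : k[X]} {γ : k} {n : ℕ}
    (hD : D ^ p - D = C γ * X ^ p ^ n) : γ = 0 := by
  have hp : p.Prime := Fact.out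
  have hpow : ∀ m, (D ^ p).coeff (m * p) = D.coeff m ^ p := fun m => by
    rw [← map_frobenius_expand, coeff_map, coeff_expand_mul hp.pos, frobenius_def]
  have hpow1 : (D ^ p).coeff 1 = 0 := by
    rw [← map_frobenius_expand, coeff_map, coeff_expand hp.pos,
      if_neg (fun h => hp.one_lt.ne' (Nat.dvd_one.1 h)), map_zero]
  have hsucc : ∀ m, D.coeff (p ^ m) ^ p - D.coeff (p ^ (m + 1)) = if m + 1 = n then γ else 0 := by
    intro m
    have := congrArg (fun f => coeff f (p ^ (m + 1))) hD
    simp only [coeff_sub, coeff_C_mul_X_pow] at this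
    rw [pow_succ p m, hpow, ← pow_succ] at this
    rw [this]
    simp only [Nat.pow_right_inj hp.one_lt]
  have hzero : -D.coeff 1 = if n = 0 then γ else 0 := by
    have := congrArg (fun f => coeff f 1) hD
    simp only [coeff_sub, coeff_C_mul_X_pow, hpow1, zero_sub] at this
    rw [this]
    refine if_congr ?_ rfl rfl
    rw [eq_comm, Nat.pow_eq_one]
    exact or_iff_right hp.one_lt.ne'
  have hlow : ∀ m, m < n → D.coeff (p ^ m) = 0 := by
    intro m
    induction m with
    | zero => intro hm; rw [if_neg hm.ne'] at hzero; simpa using hzero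
    | succ m ih =>
      intro hm
      have := hsucc m
      rw [ih (by omega), if_neg hm.ne, zero_pow hp.ne_zero] at this
      simpa using this
  have hn : D.coeff (p ^ n) = -γ := by
    rcases n with _ | n
    · simpa [neg_eq_iff_eq_neg] using hzero
    · have := hsucc n
      rw [hlow n (by omega), if_pos rfl, zero_pow hp.ne_zero] at this
      rw [← this]; ring
  have hhigh : ∀ m, D.coeff (p ^ (n + m)) = (-γ) ^ p ^ m := by
    intro m
    induction m with
    | zero => simpa using hn
    | succ m ih =>
      have := hsucc (n + m)
      rw [ih, if_neg (by omega), ← pow_mul, ← pow_succ] at this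
      exact (sub_eq_zero.1 this).symm
  have h0 := hhigh D.natDegree
  rw [coeff_eq_zero_of_natDegree_lt] at h0
  · simpa using (pow_eq_zero_iff (pow_pos hp.pos _).ne').1 h0.symm
  · exact (Nat.lt_pow_self hp.one_lt).trans_le (Nat.pow_le_pow_right hp.pos (by omega))

/-- The difference D of `B` and the explicit polynomial satisfies D^p − D = E(c)X^(p^h). -/
lemma E_eval_eq_zero_of_pow_sub_self {R : AdditivePoly p k h} {c : k} {B : k[X]}
    (hB : B ^ p - B = C c * R.toPoly + C (R.toPoly.eval c) * X) : R.E.eval c = 0 := by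
  refine eq_zero_of_pow_sub_self_eq_monomial (p := p) (D := B - R.explicitB c) (n := h) ?_
  rw [sub_pow_char]
  linear_combination hB - R.explicitB_pow_sub c

lemma B_add (R : AdditivePoly p k h) {c d : k} (hc : R.E.eval c = 0) (hd : R.E.eval d = 0) :
    R.B (c + d) = R.B c + R.B d := by
  have hcd : (R.B c + R.B d) ^ p - (R.B c + R.B d) =
      C (c + d) * R.toPoly + C (R.toPoly.eval (c + d)) * X := by
    rw [toPoly_eval_add, add_pow_char, C_add, C_add]
    linear_combination (R.isB_B hc).2 + (R.isB_B hd).2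
  exact (R.isB_B (E_eval_eq_zero_of_pow_sub_self hcd)).unique
    ⟨dvd_add (R.isB_B hc).1 (R.isB_B hd).1, hcd⟩

/-- B_c is an additive polynomial: B_c(X + t) − B_c(X) − B_c(t) is fixed by the p-th power map and
vanishes at 0, because cR + R(c)X is itself additive. -/
lemma B_comp_X_add_C (R : AdditivePoly p k h) {c : k} (hc : R.E.eval c = 0) (t : k) :
    (R.B c).comp (X + C t) = R.B c + C ((R.B c).eval t) := by
  have hB := (R.isB_B hc).2
  refine sub_eq_zero.1 (eq_zero_of_pow_sub_self_eq_zero (p := p) (t := 0) ?_ ?_)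
  · have h1 := congrArg (fun f => f.comp (X + C t)) hB
    have h2 := congrArg (fun f => C (eval t f)) hB
    simp only [sub_comp, pow_comp, add_comp, mul_comp, C_comp, X_comp, toPoly_comp_X_add_C] at h1
    simp only [eval_sub, eval_pow, eval_add, eval_mul, eval_C, eval_X, C_sub, C_pow, C_add,
      C_mul] at h2
    rw [sub_pow_char, add_pow_char]
    linear_combination h1 - h2 - hB
  · simp [(R.isB_B hc).eval_zero]

lemma B_eval_add (R : AdditivePoly p k h) {c : k} (hc : R.E.eval c = 0) (s t : k) :
    (R.B c).eval (s + t) = (R.B c).eval s + (R.B c).eval t := by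
  simpa using congrArg (eval s) (R.B_comp_X_add_C hc t)

lemma B_eval_pow_sub (R : AdditivePoly p k h) {c : k} (hc : R.E.eval c = 0) (t : k) :
    (R.B c).eval t ^ p - (R.B c).eval t = c * R.toPoly.eval t + R.toPoly.eval c * t := by
  simpa using congrArg (eval t) (R.isB_B hc).2

end Polynomials

/-! ### The space `W` and its pairing -/

section Pairing

variable [Fact p.Prime] [Algebra (ZMod p) k]

lemma mem_W {R : AdditivePoly p k h} {c : k} : c ∈ R.W ↔ R.E.eval c = 0 := Iff.rfl

/-- Every term is a p-th power except the one for i = h, which is a_h X. The derivative is thus a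
nonzero constant, which makes E separable. -/
lemma E_derivative (R : AdditivePoly p k h) (hh : 1 ≤ h) :
    derivative R.E = C (R.a (Fin.last h)) := by
  have : CharP k p := charP_of_injective_algebraMap (algebraMap (ZMod p) k).injective p
  have key : ∀ (f : k[X]) (n : ℕ), n ≠ 0 → derivative (f ^ p ^ n) = 0 := by
    intro f n hn
    rw [derivative_pow, Nat.cast_pow, CharP.cast_eq_zero, zero_pow hn]
    simp
  rw [E, derivative_add, key _ _ (by omega), zero_add, Fin.sum_univ_castSucc, derivative_add,
    derivative_sum, Finset.sum_eq_zero]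
  · simp
  · intro i _
    refine key _ _ ?_
    simp only [Fin.val_castSucc]
    omega

lemma card_W [IsAlgClosed k] (R : AdditivePoly p k h) (hh : 1 ≤ h) :
    Nat.card R.W = p ^ (2 * h) := by
  classical
  have hE : R.E ≠ 0 := by
    intro h0
    have := R.E_natDegree hh
    rw [h0, natDegree_zero] at this
    exact (pow_pos (Fact.out : p.Prime).pos _).ne this
  have hsep : R.E.Separable := by
    rw [separable_def, E_derivative R hh]
    exact ⟨0, C (R.a (Fin.last h))⁻¹, by
      rw [zero_mul, zero_add, ← C_mul, inv_mul_cancel₀ R.lead_ne_zero, C_1]⟩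
  have h1 : (R.W : Set k) = R.E.rootSet k := by
    ext c
    rw [mem_rootSet_of_ne hE, SetLike.mem_coe, mem_W, aeval_def, Algebra.algebraMap_self, eval₂_id]
  have h2 : Nat.card R.W = Nat.card (R.E.rootSet k) := by
    rw [← h1]; rfl
  rw [h2, Nat.card_eq_fintype_card, card_rootSet_eq_natDegree hsep (IsAlgClosed.splits _),
    E_natDegree R hh]

lemma finrank_W [IsAlgClosed k] (R : AdditivePoly p k h) (hh : 1 ≤ h) :
    Module.finrank (ZMod p) R.W = 2 * h := by
  have : Finite R.W := Nat.finite_of_card_ne_zero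
    (by rw [R.card_W hh]; exact (pow_pos (Fact.out : p.Prime).pos _).ne')
  have h1 := Module.natCard_eq_pow_finrank (K := ZMod p) (V := R.W)
  rw [R.card_W hh, Nat.card_zmod] at h1
  exact (Nat.pow_right_injective (Fact.out : p.Prime).two_le h1).symm

lemma B_zero (R : AdditivePoly p k h) : R.B 0 = 0 := by
  have : CharP k p := charP_of_injective_algebraMap (algebraMap (ZMod p) k).injective p
  simpa using R.B_add R.W.zero_mem R.W.zero_mem

lemma B_eval_natCast_mul (R : AdditivePoly p k h) (c : R.W) (n : ℕ) (t : k) :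
    (R.B c).eval (n * t) = n * (R.B c).eval t := by
  have : CharP k p := charP_of_injective_algebraMap (algebraMap (ZMod p) k).injective p
  induction n with
  | zero => simp [(R.isB_B c.2).eval_zero]
  | succ n ih =>
    rw [Nat.cast_succ, add_mul, one_mul, R.B_eval_add c.2, ih]
    ring

/-- The right-hand side cR(d) + R(c)d of the equation for B_c(d) is symmetric in c and d, so the
difference is fixed by Frobenius and lies in 𝔽_p. -/
lemma exists_pairing (R : AdditivePoly p k h) (c d : R.W) :
    ∃ e : ZMod p, algebraMap (ZMod p) k e = (R.B c).eval (d : k) - (R.B d).eval (c : k) := by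
  have : CharP k p := charP_of_injective_algebraMap (algebraMap (ZMod p) k).injective p
  have h1 : ((R.B c).eval (d : k) - (R.B d).eval (c : k)) ^ p =
      (R.B c).eval (d : k) - (R.B d).eval (c : k) := by
    rw [sub_pow_char]
    linear_combination R.B_eval_pow_sub c.2 d - R.B_eval_pow_sub d.2 c
  exact (bot_le : (⊥ : Subfield k) ≤ (algebraMap (ZMod p) k).fieldRange)
    ((Subfield.mem_bot_iff_pow_eq_self k p).2 h1)

/-- The pairing `ε(c, d) = B_c(d) - B_d(c)` on `W`. -/
noncomputable def pairing (R : AdditivePoly p k h) : LinearMap.BilinForm (ZMod p) R.W :=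
  have : CharP k p := charP_of_injective_algebraMap (algebraMap (ZMod p) k).injective p
  AddMonoidHom.toZModLinearMap p
    { toFun := fun c => AddMonoidHom.toZModLinearMap p
        (AddMonoidHom.mk' (fun d => (R.exists_pairing c d).choose) fun d d' =>
          (algebraMap (ZMod p) k).injective (by
            rw [map_add, (R.exists_pairing c d).choose_spec, (R.exists_pairing c d').choose_spec,
              (R.exists_pairing c (d + d')).choose_spec, Submodule.coe_add, R.B_add d.2 d'.2,
              R.B_eval_add c.2, eval_add]
            ring))
      map_zero' := by
        ext d
        refine (algebraMap (ZMod p) k).injective ?_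
        have hB0 : R.B 0 = 0 := by simpa using R.B_add R.W.zero_mem R.W.zero_mem
        change algebraMap _ _ (R.exists_pairing 0 d).choose = _
        rw [(R.exists_pairing 0 d).choose_spec]
        simp [hB0, (R.isB_B d.2).eval_zero]
      map_add' := fun c c' => by
        ext d
        refine (algebraMap (ZMod p) k).injective ?_
        change algebraMap _ _ (R.exists_pairing (c + c') d).choose = algebraMap _ _
          ((R.exists_pairing c d).choose + (R.exists_pairing c' d).choose)
        rw [map_add, (R.exists_pairing c d).choose_spec, (R.exists_pairing c' d).choose_spec,
          (R.exists_pairing (c + c') d).choose_spec, Submodule.coe_add, R.B_add c.2 c'.2,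
          R.B_eval_add d.2, eval_add]
        ring }

lemma algebraMap_pairing (R : AdditivePoly p k h) (c d : R.W) :
    algebraMap (ZMod p) k (R.pairing c d) = (R.B c).eval (d : k) - (R.B d).eval (c : k) :=
  (R.exists_pairing c d).choose_spec

lemma pairing_isAlt (R : AdditivePoly p k h) : R.pairing.IsAlt := fun c =>
  (algebraMap (ZMod p) k).injective (by rw [algebraMap_pairing, sub_self, map_zero])

/-- For fixed c ≠ 0, the condition ε(c, d) = 0 is a polynomial equation in d of degree p^(2h−1),
obtained by reading B_d(c) as a polynomial in d. It has too few roots to contain the p^(2h) elements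
of W. -/
lemma pairing_separatingLeft [IsAlgClosed k] (R : AdditivePoly p k h) (hh : 1 ≤ h) :
    R.pairing.SeparatingLeft := by
  classical
  have : CharP k p := charP_of_injective_algebraMap (algebraMap (ZMod p) k).injective p
  have hp : p.Prime := Fact.out
  intro c hc
  by_contra hc0
  have hc0' : (c : k) ≠ 0 := fun h0 => hc0 (Subtype.ext h0)
  have hdeg : (R.swappedB c - R.explicitB c).natDegree = p ^ (2 * h - 1) := by
    rw [natDegree_sub_eq_left_of_natDegree_lt, swappedB_natDegree R hh hc0']
    rw [swappedB_natDegree R hh hc0']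
    exact (R.explicitB_natDegree_le c).trans_lt (Nat.pow_lt_pow_right hp.one_lt (by omega))
  have hne : R.swappedB c - R.explicitB c ≠ 0 := by
    intro h0
    rw [h0, natDegree_zero] at hdeg
    exact (pow_pos hp.pos _).ne hdeg
  have hsub : (R.W : Set k) ⊆ (R.swappedB c - R.explicitB c).rootSet k := by
    intro d hd
    rw [mem_rootSet_of_ne hne, aeval_def, Algebra.algebraMap_self, eval₂_id, eval_sub,
      swappedB_eval, ← R.B_eq_explicitB hd, ← R.B_eq_explicitB c.2, sub_eq_zero, eq_comm,
      ← sub_eq_zero]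
    have := R.algebraMap_pairing c ⟨d, hd⟩
    rw [hc, map_zero] at this
    exact this.symm
  have h1 := Set.ncard_le_ncard hsub (rootSet_finite _ _)
  have h2 : (R.W : Set k).ncard = p ^ (2 * h) := R.card_W hh
  have h3 : ((R.swappedB c - R.explicitB c).rootSet k).ncard ≤ p ^ (2 * h - 1) :=
    hdeg ▸ ncard_rootSet_le _ _
  have h4 : p ^ (2 * h - 1) < p ^ (2 * h) := Nat.pow_lt_pow_right hp.one_lt (by omega)
  omega

lemma pairing_nondegenerate [IsAlgClosed k] (R : AdditivePoly p k h) (hh : 1 ≤ h) :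
    R.pairing.Nondegenerate := by
  refine ⟨R.pairing_separatingLeft hh, fun d hd => R.pairing_separatingLeft hh d fun c => ?_⟩
  have := LinearMap.BilinForm.IsAlt.neg_eq R.pairing_isAlt c d
  rw [← this, hd, neg_zero]

end Pairing

end AdditivePoly

/-! ### Pole orders and valuation-theoretic preliminaries -/

namespace AdditivePoly

variable {p : ℕ} {k : Type*} [Field k] {h : ℕ}

/-- The pole order at infinity of `∑ f_i(x) y^i`, where the `f_i` are the coefficients of `q`. -/
noncomputable def poleOrder (p h : ℕ) (q : k[X][X]) : ℕ :=
  q.support.sup fun i => p * (q.coeff i).natDegree + i * (p ^ h + 1)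

lemma le_poleOrder {q : k[X][X]} {i : ℕ} (hi : q.coeff i ≠ 0) :
    p * (q.coeff i).natDegree + i * (p ^ h + 1) ≤ poleOrder p h q :=
  Finset.le_sup (f := fun i => p * (q.coeff i).natDegree + i * (p ^ h + 1)) (mem_support_iff.2 hi)

/-- The integral closure is the intersection of the valuation rings above it; this turns regularity
at all points into integrality. -/
lemma isIntegral_of_forall_mem_valuationSubring {A F : Type*} [CommRing A] [Field F]
    [Algebra A F] {f : F}
    (hf : ∀ O : ValuationSubring F, (∀ a : A, algebraMap A F a ∈ O) → f ∈ O) :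
    IsIntegral A f := by
  by_contra h0
  have : IsIntegrallyClosedIn (integralClosure A F).toSubring F :=
    inferInstanceAs (IsIntegrallyClosedIn (integralClosure A F) F)
  obtain ⟨V, hV, hfV⟩ := Subring.exists_le_valuationSubring_of_isIntegrallyClosedIn
    (R := (integralClosure A F).toSubring) (x := f) h0
  exact hfV (hf V fun a => hV ((integralClosure A F).algebraMap_mem a))

variable [Fact p.Prime]

lemma valuation_pow_sub_self {F : Type*} [Field F] (O : ValuationSubring F) {z : F}
    (hz : 1 < O.valuation z) : O.valuation (z ^ p - z) = O.valuation z ^ p := by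
  rw [Valuation.map_sub_eq_of_lt_left, map_pow]
  rw [map_pow]
  exact lt_self_pow₀ hz (Fact.out : p.Prime).one_lt

lemma artinSchreier_natDegree_monic (R : AdditivePoly p k h) :
    R.artinSchreier.natDegree = p ∧ R.artinSchreier.Monic := by
  have hp := (Fact.out : p.Prime).one_lt
  have h1 : R.artinSchreier =
      X ^ p - (X + C (algebraMap k[X] (RatFunc k) (X * R.toPoly))) := by
    rw [artinSchreier, sub_sub]
  have h2 : (X + C (algebraMap k[X] (RatFunc k) (X * R.toPoly)) : (RatFunc k)[X]).natDegree
      < (X ^ p : (RatFunc k)[X]).natDegree := by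
    rw [natDegree_X_add_C, natDegree_X_pow]; exact hp
  constructor
  · rw [h1, natDegree_sub_eq_left_of_natDegree_lt h2, natDegree_X_pow]
  · rw [h1]
    refine monic_X_pow_sub ?_
    rw [degree_X_add_C]
    exact_mod_cast hp

variable [Fact (p ≠ 2)] [Algebra (ZMod p) k]

/-! ### The function field -/

section FunctionField

lemma algebraMap_eq_aeval_x (R : AdditivePoly p k h) (f : k[X]) :
    algebraMap k[X] R.FunctionField f = aeval R.x f := by
  have : IsScalarTower.toAlgHom k k[X] R.FunctionField = aeval R.x := by
    refine Polynomial.algHom_ext ?_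
    rw [aeval_X]
    change AdjoinRoot.of _ (algebraMap k[X] (RatFunc k) X) = R.x
    rw [RatFunc.algebraMap_X]
    rfl
  exact DFunLike.congr_fun this f

lemma algebraMap_injective (R : AdditivePoly p k h) :
    Function.Injective (algebraMap k[X] R.FunctionField) := by
  rw [IsScalarTower.algebraMap_eq k[X] (RatFunc k) R.FunctionField]
  exact (algebraMap (RatFunc k) R.FunctionField).injective.comp
    (IsFractionRing.injective k[X] (RatFunc k))

lemma aeval_x_injective (R : AdditivePoly p k h) :
    Function.Injective (aeval R.x : k[X] →ₐ[k] R.FunctionField) := fun f g hfg =>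
  R.algebraMap_injective (by rw [algebraMap_eq_aeval_x, algebraMap_eq_aeval_x, hfg])

instance charP_functionField (R : AdditivePoly p k h) : CharP R.FunctionField p :=
  have : CharP k p := charP_of_injective_algebraMap (algebraMap (ZMod p) k).injective p
  charP_of_injective_algebraMap (algebraMap k R.FunctionField).injective p

lemma y_pow_sub (R : AdditivePoly p k h) :
    R.y ^ p - R.y = R.x * aeval R.x R.toPoly := by
  have h1 : aeval R.y (X ^ p - X - C (algebraMap k[X] (RatFunc k) (X * R.toPoly))) = 0 := by
    change aeval R.y R.artinSchreier = 0
    rw [y, AdjoinRoot.aeval_eq, AdjoinRoot.mk_self]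
  have h2 : algebraMap (RatFunc k) R.FunctionField (algebraMap k[X] (RatFunc k) (X * R.toPoly)) =
      aeval R.x (X * R.toPoly) := by
    rw [← algebraMap_eq_aeval_x, ← IsScalarTower.algebraMap_apply]
  rw [map_sub, map_sub, map_pow, aeval_X, aeval_C, h2, map_mul, aeval_X] at h1
  exact sub_eq_zero.1 h1

lemma eq_zero_of_aeval_y_eq_zero (R : AdditivePoly p k h) {q : k[X][X]} (hq : q.natDegree < p)
    (h0 : aeval R.y q = 0) : q = 0 := by
  rw [← aeval_map_algebraMap (RatFunc k), y, AdjoinRoot.aeval_eq, AdjoinRoot.mk_eq_zero] at h0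
  have h1 := eq_zero_of_dvd_of_natDegree_lt h0 (by
    rw [R.artinSchreier_natDegree_monic.1]
    exact natDegree_map_le.trans_lt hq)
  rwa [Polynomial.map_eq_zero_iff (IsFractionRing.injective k[X] (RatFunc k))] at h1

lemma exists_mul_eq_aeval_y (R : AdditivePoly p k h) (f : R.FunctionField) :
    ∃ d : k[X], d ≠ 0 ∧ ∃ q : k[X][X], q.natDegree < p ∧
      aeval R.x d * f = aeval R.y q := by
  obtain ⟨g, rfl⟩ := AdjoinRoot.mk_surjective f
  have hm := R.artinSchreier_natDegree_monic
  have hlt : (g %ₘ R.artinSchreier).natDegree < p := by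
    refine (natDegree_modByMonic_lt g hm.2 fun h1 => ?_).trans_eq hm.1
    have := hm.1
    rw [h1, natDegree_one] at this
    exact (Fact.out : p.Prime).ne_zero this.symm
  have hmk : AdjoinRoot.mk R.artinSchreier g = AdjoinRoot.mk _ (g %ₘ R.artinSchreier) := by
    rw [AdjoinRoot.mk_eq_mk]
    exact ⟨_, (sub_eq_iff_eq_add'.2 (modByMonic_add_div g R.artinSchreier).symm)⟩
  obtain ⟨b, hb0, hb⟩ := IsLocalization.integerNormalization_spec (nonZeroDivisors k[X])
    (g %ₘ R.artinSchreier)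
  set q := IsLocalization.integerNormalization (nonZeroDivisors k[X]) (g %ₘ R.artinSchreier)
  refine ⟨b, nonZeroDivisors.ne_zero hb0, q, ?_, ?_⟩
  · rw [← natDegree_map_eq_of_injective (IsFractionRing.injective k[X] (RatFunc k)), hb]
    exact (natDegree_smul_le _ _).trans_lt hlt
  · rw [← aeval_map_algebraMap (RatFunc k) R.y q, hb, hmk, ← algebraMap_eq_aeval_x, ← Algebra.smul_def,
      y, AdjoinRoot.aeval_eq]
    rfl

lemma algHom_ext {R : AdditivePoly p k h} {A : Type*} [Field A] [Algebra k A]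
    {f g : R.FunctionField →ₐ[k] A} (hx : f R.x = g R.x) (hy : f R.y = g R.y) : f = g := by
  have h1 : ∀ d : k[X], f (aeval R.x d) = g (aeval R.x d) := fun d => by
    rw [← aeval_algHom_apply, ← aeval_algHom_apply, hx]
  have h2 : ∀ q : k[X][X], f (aeval R.y q) = g (aeval R.y q) := fun q => by
    rw [aeval_eq_sum_range, map_sum, map_sum]
    refine Finset.sum_congr rfl fun i _ => ?_
    rw [Algebra.smul_def, algebraMap_eq_aeval_x, map_mul, map_mul, h1, map_pow, map_pow, hy]
  refine AlgHom.ext fun z => ?_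
  obtain ⟨d, hd, q, -, hq⟩ := R.exists_mul_eq_aeval_y z
  have h3 := congrArg f hq
  rw [h2, ← hq, map_mul, map_mul, h1] at h3
  refine mul_left_cancel₀ ?_ h3
  rw [map_ne_zero_iff g (RingHom.injective (g : R.FunctionField →+* A)), map_ne_zero_iff _ R.aeval_x_injective]
  exact hd

/-- The `k`-homomorphism from the function field with prescribed values at `x` and `y`. -/
lemma exists_algHom (R : AdditivePoly p k h) {A : Type*} [Field A] [Algebra k A] {x' y' : A}
    (hx : Function.Injective (aeval x' : k[X] →ₐ[k] A))
    (hxy : y' ^ p - y' = x' * aeval x' R.toPoly) :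
    ∃ f : R.FunctionField →ₐ[k] A, f R.x = x' ∧ f R.y = y' := by
  let φ : RatFunc k →ₐ[k] A := RatFunc.liftAlgHom (aeval x')
    (nonZeroDivisors_le_comap_nonZeroDivisors_of_injective _ hx)
  have hφ : ∀ d : k[X], φ (algebraMap k[X] (RatFunc k) d) = aeval x' d := fun d => by
    have := RatFunc.liftAlgHom_apply_div (aeval x')
      (nonZeroDivisors_le_comap_nonZeroDivisors_of_injective _ hx) d 1
    simpa using this
  have hφx : φ RatFunc.X = x' := by
    rw [← RatFunc.algebraMap_X, hφ, aeval_X]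
  refine ⟨AdjoinRoot.liftAlgHom _ φ y' ?_, ?_, ?_⟩
  · rw [artinSchreier, eval₂_sub, eval₂_sub, eval₂_X_pow, eval₂_X, eval₂_C]
    simp only [RingHom.coe_coe]
    rw [hφ, map_mul, aeval_X, hxy, sub_self]
  · exact (AdjoinRoot.liftAlgHom_of ..).trans hφx
  · exact AdjoinRoot.liftAlgHom_root ..

end FunctionField

/-! ### The point at infinity -/

section Infinity

variable {R : AdditivePoly p k h} {O : ValuationSubring R.FunctionField}

/-- If x were regular, then so would be y^p − y, whereas a pole of y would give it a pole. Hence x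
has a pole in any case. -/
lemma IsAtInfinity.one_lt_valuation_x (hO : R.IsAtInfinity O) : 1 < O.valuation R.x := by
  by_contra hx
  rw [not_lt, ValuationSubring.valuation_le_one_iff] at hx
  have hy : 1 < O.valuation R.y := by
    rw [← not_le, ValuationSubring.valuation_le_one_iff]
    exact hO.2.resolve_left (not_not.2 hx)
  have h1 := valuation_pow_sub_self (p := p) O hy
  have h2 : R.x * aeval R.x R.toPoly ∈ O := by
    refine mul_mem hx ?_
    rw [aeval_eq_sum_range]
    refine sum_mem fun i _ => ?_
    rw [Algebra.smul_def]
    exact mul_mem (hO.1 _) (pow_mem hx _)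
  rw [y_pow_sub] at h1
  rw [← ValuationSubring.valuation_le_one_iff, h1] at h2
  exact (one_lt_pow₀ hy (Fact.out : p.Prime).ne_zero).not_ge h2

lemma IsAtInfinity.valuation_algebraMap (hO : R.IsAtInfinity O) {c : k} (hc : c ≠ 0) :
    O.valuation (algebraMap k R.FunctionField c) = 1 := by
  refine le_antisymm ((ValuationSubring.valuation_le_one_iff _ _).2 (hO.1 c)) ?_
  have := (ValuationSubring.valuation_le_one_iff _ _).2 (hO.1 c⁻¹)
  rw [map_inv₀, map_inv₀] at this
  rwa [inv_le_one₀] at this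
  rw [zero_lt_iff, (Valuation.ne_zero_iff _)]
  exact (_root_.map_ne_zero _).2 hc

lemma IsAtInfinity.valuation_aeval_x (hO : R.IsAtInfinity O) {f : k[X]} (hf : f ≠ 0) :
    O.valuation (aeval R.x f) = O.valuation R.x ^ f.natDegree := by
  classical
  have hlead : O.valuation (f.coeff f.natDegree • R.x ^ f.natDegree) =
      O.valuation R.x ^ f.natDegree := by
    rw [Algebra.smul_def, map_mul, map_pow, hO.valuation_algebraMap (by simpa using hf), one_mul]
  rw [aeval_eq_sum_range, Valuation.map_sum_eq_of_lt _ (j := f.natDegree) (by simp), hlead]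
  intro i hi
  rw [hlead, Algebra.smul_def, map_mul, map_pow]
  have hi' : i < f.natDegree := by
    simp only [Finset.mem_sdiff, Finset.mem_range, Finset.mem_singleton] at hi
    omega
  calc _ ≤ 1 * O.valuation R.x ^ i :=
        mul_le_mul_left ((ValuationSubring.valuation_le_one_iff _ _).2 (hO.1 _)) _
    _ < _ := by
      rw [one_mul]
      exact pow_lt_pow_right₀ hO.one_lt_valuation_x hi'

lemma IsAtInfinity.valuation_y (hO : R.IsAtInfinity O) :
    O.valuation R.y ^ p = O.valuation R.x ^ (p ^ h + 1) := by
  have h1 : O.valuation (R.y ^ p - R.y) = O.valuation R.x ^ (p ^ h + 1) := by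
    rw [y_pow_sub, map_mul, hO.valuation_aeval_x R.toPoly_ne_zero, toPoly_natDegree, pow_succ']
  rw [← h1, valuation_pow_sub_self]
  by_contra hy
  rw [not_lt, ValuationSubring.valuation_le_one_iff] at hy
  have h2 := (ValuationSubring.valuation_le_one_iff _ _).2 (sub_mem (pow_mem hy p) hy)
  rw [h1] at h2
  exact (one_lt_pow₀ hO.one_lt_valuation_x (by omega)).not_ge h2

/-- The inverse of a local parameter at infinity. -/
noncomputable def t (R : AdditivePoly p k h) : R.FunctionField := R.y / R.x ^ p ^ (h - 1)

/-- Multiplicatively, p · ord(y) = (p^h + 1) · ord(x); removing p^h · ord(x) leaves p · ord(t) =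
ord(x). So ord(x) and ord(y) are p and p^h + 1 times ord(t). -/
lemma IsAtInfinity.valuation_t_pow (hO : R.IsAtInfinity O) (hh : 1 ≤ h) :
    O.valuation R.t ^ p = O.valuation R.x := by
  have hx := zero_lt_one.trans hO.one_lt_valuation_x
  rw [t, map_div₀, div_pow, hO.valuation_y, map_pow, ← pow_mul, ← pow_succ, Nat.sub_add_cancel hh,
    pow_succ, mul_div_assoc, mul_comm, div_mul_cancel₀]
  exact (pow_pos hx _).ne'

lemma IsAtInfinity.one_lt_valuation_t (hO : R.IsAtInfinity O) (hh : 1 ≤ h) :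
    1 < O.valuation R.t := by
  have h1 := hO.one_lt_valuation_x
  rw [← hO.valuation_t_pow hh] at h1
  exact lt_of_not_ge fun h2 => h1.not_ge (pow_le_one₀ zero_le h2)

lemma IsAtInfinity.valuation_y_eq (hO : R.IsAtInfinity O) (hh : 1 ≤ h) :
    O.valuation R.y = O.valuation R.t ^ (p ^ h + 1) := by
  rw [← pow_left_inj₀ zero_le zero_le (Fact.out : p.Prime).ne_zero, hO.valuation_y,
    ← hO.valuation_t_pow hh, pow_right_comm]

/-- No cancellation occurs between different powers of y: as h ≥ 1, the pole order p · deg + i(p^h +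
1) of the i-th term is congruent to i modulo p, and i < p. -/
lemma IsAtInfinity.valuation_aeval_y (hO : R.IsAtInfinity O) (hh : 1 ≤ h) {q : k[X][X]}
    (hq : q.natDegree < p) (hq0 : q ≠ 0) :
    O.valuation (aeval R.y q) = O.valuation R.t ^ poleOrder p h q := by
  classical
  have hp : p.Prime := Fact.out
  set w : ℕ → ℕ := fun i => p * (q.coeff i).natDegree + i * (p ^ h + 1) with hw
  have hterm : ∀ i, q.coeff i ≠ 0 → O.valuation (q.coeff i • R.y ^ i) = O.valuation R.t ^ w i := by
    intro i hi
    rw [Algebra.smul_def, algebraMap_eq_aeval_x, map_mul, map_pow, hO.valuation_aeval_x hi,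
      hO.valuation_y_eq hh, ← hO.valuation_t_pow hh, ← pow_mul, ← pow_mul, ← pow_add,
      mul_comm (p ^ h + 1)]
  obtain ⟨j, hj, hjw⟩ := Finset.exists_mem_eq_sup q.support (nonempty_support_iff.2 hq0) w
  have hinj : ∀ i ∈ q.support, i ≠ j → w i ≠ w j := by
    intro i hi hij hwij
    have hi' : i < p := (le_natDegree_of_mem_supp i hi).trans_lt hq
    have hj' : j < p := (le_natDegree_of_mem_supp j hj).trans_lt hq
    have h1 : ∀ n, w n % p = n % p := fun n => by
      obtain ⟨m, rfl⟩ : ∃ m, h = m + 1 := ⟨h - 1, by omega⟩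
      have : w n = n + p * ((q.coeff n).natDegree + n * p ^ m) := by simp only [hw]; ring
      rw [this, Nat.add_mul_mod_self_left]
    have h2 := h1 i
    rw [hwij, h1 j, Nat.mod_eq_of_lt hi', Nat.mod_eq_of_lt hj'] at h2
    exact hij h2.symm
  have hpole : poleOrder p h q = w j := hjw
  rw [aeval_eq_sum_range' (n := p) hq, Valuation.map_sum_eq_of_lt _ (j := j),
    hterm j (mem_support_iff.1 hj), hpole]
  · exact Finset.mem_range.2 ((le_natDegree_of_mem_supp j hj).trans_lt hq)
  · intro i hi
    simp only [Finset.mem_sdiff, Finset.mem_singleton] at hi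
    rw [hterm j (mem_support_iff.1 hj)]
    have ht := hO.one_lt_valuation_t hh
    by_cases hi0 : q.coeff i = 0
    · rw [hi0, zero_smul, map_zero]
      exact pow_pos (zero_lt_one.trans ht) _
    · rw [hterm i hi0]
      refine pow_lt_pow_right₀ ht (lt_of_le_of_ne ?_ (hinj i (mem_support_iff.2 hi0) hi.2))
      rw [← hpole]
      exact le_poleOrder hi0

lemma exists_valuation_eq_zpow (R : AdditivePoly p k h) (hh : 1 ≤ h) {f : R.FunctionField}
    (hf : f ≠ 0) : ∃ n : ℤ, ∀ O : ValuationSubring R.FunctionField, R.IsAtInfinity O →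
      O.valuation f = O.valuation R.t ^ n := by
  obtain ⟨d, hd, q, hq, hdq⟩ := R.exists_mul_eq_aeval_y f
  have hd' : aeval R.x d ≠ 0 := by rwa [map_ne_zero_iff _ R.aeval_x_injective]
  have hq0 : q ≠ 0 := by
    rintro rfl
    rw [map_zero] at hdq
    exact mul_ne_zero hd' hf hdq
  refine ⟨poleOrder p h q - p * d.natDegree, fun O hO => ?_⟩
  have h1 := congrArg O.valuation hdq
  rw [map_mul, hO.valuation_aeval_x hd, hO.valuation_aeval_y hh hq hq0, ← hO.valuation_t_pow hh,
    ← pow_mul] at h1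
  have ht := (zero_lt_one.trans (hO.one_lt_valuation_t hh)).ne'
  rw [zpow_sub₀ ht, eq_div_iff (zpow_ne_zero _ ht), mul_comm]
  exact_mod_cast h1

/-- The exponent n from `exists_valuation_eq_zpow` depends on the function alone, and membership in
either ring means n ≤ 0. -/
lemma IsAtInfinity.eq (hh : 1 ≤ h) {O' : ValuationSubring R.FunctionField}
    (hO : R.IsAtInfinity O) (hO' : R.IsAtInfinity O') : O = O' := by
  have key : ∀ (O : ValuationSubring R.FunctionField), R.IsAtInfinity O → ∀ n : ℤ,
      O.valuation R.t ^ n ≤ 1 ↔ n ≤ 0 := fun O hO n => by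
    rw [← zpow_zero (O.valuation R.t), zpow_le_zpow_iff_right₀ (hO.one_lt_valuation_t hh)]
  ext f
  rcases eq_or_ne f 0 with rfl | hf
  · simp
  obtain ⟨n, hn⟩ := R.exists_valuation_eq_zpow hh hf
  rw [← ValuationSubring.valuation_le_one_iff, ← ValuationSubring.valuation_le_one_iff, hn O hO,
    hn O' hO', key O hO, key O' hO']

/-- Since x is transcendental over k, it is not integral over k, so some valuation ring containing k
omits it. -/
lemma exists_isAtInfinity (R : AdditivePoly p k h) :
    ∃ O : ValuationSubring R.FunctionField, R.IsAtInfinity O := by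
  have h1 : ¬ IsIntegral k R.x := by
    rintro ⟨f, hf, h0⟩
    exact hf.ne_zero (R.aeval_x_injective (by rwa [map_zero, aeval_def]))
  have h2 := mt isIntegral_of_forall_mem_valuationSubring h1
  push Not at h2
  obtain ⟨O, hO, hx⟩ := h2
  exact ⟨O, hO, Or.inl hx⟩

lemma mem_Aut0_iff {σ : R.CurveAut} (hh : 1 ≤ h) (hO : R.IsAtInfinity O) :
    σ ∈ R.Aut0 ↔ pullback σ • O = O := by
  simp only [Aut0, Subgroup.mem_iInf]
  exact ⟨fun hσ => hσ O hO, fun hσ O' hO' => by rwa [hO'.eq hh hO]⟩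

end Infinity

end AdditivePoly

namespace AdditivePoly

variable {p : ℕ} {k : Type*} [Field k] {h : ℕ}
/-! ### The affine coordinate ring -/

section CoordinateRing

variable [Fact p.Prime] [Algebra (ZMod p) k]

lemma artinSchreier_derivative (R : AdditivePoly p k h) : derivative R.artinSchreier = -1 := by
  have : CharP k p := charP_of_injective_algebraMap (algebraMap (ZMod p) k).injective p
  have : CharP (RatFunc k) p :=
    charP_of_injective_algebraMap (algebraMap k (RatFunc k)).injective p
  rw [artinSchreier, derivative_sub, derivative_sub, derivative_X_pow, CharP.cast_eq_zero]
  simp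

variable [Fact (p ≠ 2)]

instance isSeparable_functionField (R : AdditivePoly p k h) :
    Algebra.IsSeparable (RatFunc k) R.FunctionField := by
  have hm := R.artinSchreier_natDegree_monic.2
  have hy : IsSeparable (RatFunc k) R.y := by
    have : minpoly (RatFunc k) R.y = R.artinSchreier := by
      rw [y, AdjoinRoot.minpoly_root hm.ne_zero, hm.leadingCoeff, inv_one, C_1, mul_one]
    rw [IsSeparable, this, separable_def, artinSchreier_derivative]
    exact isCoprime_one_right.neg_right
  rw [← separableClosure.eq_top_iff, eq_top_iff,
    ← IntermediateField.adjoin_eq_top_of_algebra _ _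
      (AdjoinRoot.adjoinRoot_eq_top (f := R.artinSchreier)),
    IntermediateField.adjoin_le_iff, Set.singleton_subset_iff]
  exact hy

/-- A function without poles outside of the point at infinity is a polynomial in `x` and `y`. -/
lemma exists_eq_aeval_y_of_isIntegral (R : AdditivePoly p k h) {f : R.FunctionField}
    (hf : IsIntegral k[X] f) : ∃ q : k[X][X], q.natDegree < p ∧ f = aeval R.y q := by
  have hp := (Fact.out : p.Prime)
  have hm := R.artinSchreier_natDegree_monic.2
  let g : k[X][X] := X ^ p - (X + C (X * R.toPoly))
  have hgm : g.Monic := by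
    refine monic_X_pow_sub ?_
    rw [degree_X_add_C]
    exact_mod_cast hp.one_lt
  have hgd : g.natDegree = p := by
    rw [natDegree_sub_eq_left_of_natDegree_lt, natDegree_X_pow]
    rw [natDegree_X_add_C, natDegree_X_pow]
    exact hp.one_lt
  have hgy : aeval R.y g = 0 := by
    simp only [g, map_sub, map_add, map_pow, aeval_X, aeval_C, algebraMap_eq_aeval_x, map_mul]
    linear_combination R.y_pow_sub
  let pb := AdjoinRoot.powerBasis hm.ne_zero
  have : Module.Finite (RatFunc k) R.FunctionField := pb.finite
  have hint : IsIntegral k[X] pb.gen := ⟨g, hgm, hgy⟩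
  have h1 := Algebra.discr_mul_isIntegral_mem_adjoin (RatFunc k) hint hf
  -- Up to sign the discriminant is the norm of the derivative of Y^p − Y − xR(x) at y, and this
  -- derivative is −1. Being ±1, it can be removed from `h1`.
  obtain ⟨n, hn⟩ : ∃ n : ℕ, Algebra.discr (RatFunc k) pb.basis = (-1) ^ n := by
    rw [Algebra.discr_powerBasis_eq_norm, AdjoinRoot.minpoly_powerBasis_gen_of_monic hm,
      artinSchreier_derivative]
    have : aeval pb.gen (-1 : (RatFunc k)[X]) = algebraMap (RatFunc k) _ (-1) := by simp
    rw [this, Algebra.norm_algebraMap, ← pow_add]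
    exact ⟨_, rfl⟩
  rw [hn] at h1
  have h2 : f ∈ Algebra.adjoin k[X] {pb.gen} := by
    rcases neg_one_pow_eq_or (RatFunc k) n with h0 | h0 <;> rw [h0] at h1
    · simpa using h1
    · simpa using h1
  rw [Algebra.adjoin_singleton_eq_range_aeval] at h2
  obtain ⟨q, hq⟩ := h2
  refine ⟨q %ₘ g, (natDegree_modByMonic_lt _ hgm fun h0 => ?_).trans_eq hgd, ?_⟩
  · rw [h0, natDegree_one] at hgd
    exact hp.ne_zero hgd.symm
  · rw [← hq]
    change aeval R.y q = _
    conv_lhs => rw [← modByMonic_add_div q g, map_add, map_mul, hgy, zero_mul, add_zero]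

end CoordinateRing

/-! ### Automorphisms fixing infinity -/

section Stabilizer

variable [Fact p.Prime] [Fact (p ≠ 2)] [Algebra (ZMod p) k]
variable {R : AdditivePoly p k h} {O : ValuationSubring R.FunctionField}

lemma mem_iff_of_smul_eq {e : R.FunctionField ≃ₐ[k] R.FunctionField} (he : e • O = O)
    (f : R.FunctionField) : e f ∈ O ↔ f ∈ O := by
  conv_lhs => rw [← he]
  exact ValuationSubring.smul_mem_pointwise_smul_iff

lemma valuation_apply_le {e : R.FunctionField ≃ₐ[k] R.FunctionField} (he : e • O = O)
    {f g : R.FunctionField} (hfg : O.valuation f ≤ O.valuation g) :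
    O.valuation (e f) ≤ O.valuation (e g) := by
  rcases eq_or_ne g 0 with rfl | hg
  · rw [map_zero, le_zero_iff, Valuation.zero_iff] at hfg
    rw [hfg]
  have hg' : 0 < O.valuation g := zero_lt_iff.2 ((Valuation.ne_zero_iff _).2 hg)
  have heg' : 0 < O.valuation (e g) :=
    zero_lt_iff.2 ((Valuation.ne_zero_iff _).2 ((map_ne_zero_iff e e.injective).2 hg))
  rw [← div_le_one₀ hg', ← map_div₀, ValuationSubring.valuation_le_one_iff,
    ← mem_iff_of_smul_eq he, map_div₀, ← ValuationSubring.valuation_le_one_iff, map_div₀,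
    div_le_one₀ heg'] at hfg
  exact hfg

lemma valuation_apply_eq {e : R.FunctionField ≃ₐ[k] R.FunctionField} (he : e • O = O)
    {f g : R.FunctionField} (hfg : O.valuation f = O.valuation g) :
    O.valuation (e f) = O.valuation (e g) :=
  le_antisymm (valuation_apply_le he hfg.le) (valuation_apply_le he hfg.ge)

/-- All values at infinity are integral powers of that of t, so `e` and its inverse raise it to
exponents m and n with mn = 1. As `e` preserves poles at infinity, m is positive. -/
lemma IsAtInfinity.valuation_apply_t (hO : R.IsAtInfinity O) (hh : 1 ≤ h)
    {e : R.FunctionField ≃ₐ[k] R.FunctionField} (he : e • O = O) :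
    O.valuation (e R.t) = O.valuation R.t := by
  have ht := hO.one_lt_valuation_t hh
  have ht0 : R.t ≠ 0 := fun h0 => by
    rw [h0, map_zero] at ht
    exact not_lt_zero ht
  obtain ⟨m, hm⟩ := R.exists_valuation_eq_zpow hh ((map_ne_zero_iff e e.injective).2 ht0)
  obtain ⟨n, hn⟩ := R.exists_valuation_eq_zpow hh ((map_ne_zero_iff e.symm e.symm.injective).2 ht0)
  have hm := hm O hO
  have hn := hn O hO
  rw [← map_zpow₀] at hn
  have h1 := valuation_apply_eq he hn
  rw [AlgEquiv.apply_symm_apply, map_zpow₀, map_zpow₀, hm, ← zpow_mul] at h1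
  have h2 : (1 : ℤ) = m * n :=
    zpow_right_injective₀ (zero_lt_one.trans ht) ht.ne' (by simpa using h1)
  have h3 : 0 < m := by
    by_contra h3
    have h4 : O.valuation (e R.t) ≤ 1 := by
      rw [hm, ← zpow_zero (O.valuation R.t)]
      exact zpow_le_zpow_right₀ ht.le (not_lt.1 h3)
    rw [ValuationSubring.valuation_le_one_iff, mem_iff_of_smul_eq he,
      ← ValuationSubring.valuation_le_one_iff] at h4
    exact ht.not_ge h4
  rcases Int.eq_one_or_neg_one_of_mul_eq_one h2.symm with rfl | rfl
  · rw [hm, zpow_one]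
  · omega

/-- An automorphism fixing infinity maps `x` and `y` to polynomials in `x` and `y`. -/
lemma IsAtInfinity.exists_apply_eq (hO : R.IsAtInfinity O) (hh : 1 ≤ h)
    {e : R.FunctionField ≃ₐ[k] R.FunctionField} (he : e • O = O) {f : R.FunctionField} (m : ℕ)
    (hf : O.valuation f = O.valuation R.t ^ m)
    (hreg : ∀ O' : ValuationSubring R.FunctionField, R.x ∈ O' → R.y ∈ O' → f ∈ O') :
    ∃ q : k[X][X], q.natDegree < p ∧ e f = aeval R.y q ∧ poleOrder p h q ≤ m := by
  -- A valuation ring `O'` over k[x] is not the one at infinity, and neither is its translate by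
  -- `e⁻¹`, because `e` fixes infinity. The translate therefore contains x and y, hence f, so `e f`
  -- lies in `O'`.
  have hint : IsIntegral k[X] (e f) := by
    refine isIntegral_of_forall_mem_valuationSubring fun O' hO' => ?_
    have hk : ∀ c : k, algebraMap k R.FunctionField c ∈ O' := fun c => by
      have := hO' (C c)
      rwa [algebraMap_eq_aeval_x, aeval_C] at this
    have hx : R.x ∈ O' := by
      have := hO' X
      rwa [algebraMap_eq_aeval_x, aeval_X] at this
    have hne : O' ≠ O := by
      rintro rfl
      have := hO.one_lt_valuation_x
      rw [← not_le, ValuationSubring.valuation_le_one_iff] at this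
      exact this hx
    have hmem : ∀ z, z ∈ e⁻¹ • O' ↔ e z ∈ O' := fun z => by
      rw [ValuationSubring.mem_inv_pointwise_smul_iff]
      rfl
    have h1 : ¬ R.IsAtInfinity (e⁻¹ • O') := by
      intro h1
      refine hne ?_
      rw [← h1.eq hh hO, smul_inv_smul] at he
      rw [he, h1.eq hh hO]
    have h2 : R.x ∈ e⁻¹ • O' ∧ R.y ∈ e⁻¹ • O' := by
      by_contra h2
      refine h1 ⟨fun c => ?_, by tauto⟩
      rw [hmem, AlgEquiv.commutes]
      exact hk c
    exact (hmem f).1 (hreg _ h2.1 h2.2)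
  obtain ⟨q, hq, hqf⟩ := R.exists_eq_aeval_y_of_isIntegral hint
  refine ⟨q, hq, hqf, ?_⟩
  rcases eq_or_ne q 0 with rfl | hq0
  · simp [poleOrder]
  have h1 := hO.valuation_aeval_y hh hq hq0
  rw [← map_pow] at hf
  rw [← hqf, valuation_apply_eq he hf, map_pow, map_pow, hO.valuation_apply_t hh he] at h1
  exact (pow_right_injective₀ (zero_lt_one.trans (hO.one_lt_valuation_t hh))
    (hO.one_lt_valuation_t hh).ne' h1).ge

/-- The image has pole order at most p, which is less than p^h + 1 and so excludes y, and excludes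
powers of x beyond the first. -/
lemma IsAtInfinity.exists_apply_x_eq (hO : R.IsAtInfinity O) (hh : 1 ≤ h)
    {e : R.FunctionField ≃ₐ[k] R.FunctionField} (he : e • O = O) :
    ∃ a b : k, e R.x = algebraMap k _ a * R.x + algebraMap k _ b := by
  have hp := (Fact.out : p.Prime)
  obtain ⟨q, -, hqx, hpole⟩ := hO.exists_apply_eq hh he p (hO.valuation_t_pow hh).symm
    fun _ hx _ => hx
  have hph : p ≤ p ^ h := Nat.le_self_pow (by omega) p
  have h1 : q = C (q.coeff 0) := by
    ext1 i
    rcases Nat.eq_zero_or_pos i with rfl | hi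
    · simp
    rw [coeff_C_of_ne_zero hi.ne']
    by_contra h0
    have := (le_poleOrder (p := p) (h := h) h0).trans hpole
    have : 1 * (p ^ h + 1) ≤ i * (p ^ h + 1) := Nat.mul_le_mul_right _ hi
    omega
  have h2 : (q.coeff 0).natDegree ≤ 1 := by
    by_cases h0 : q.coeff 0 = 0
    · simp [h0]
    have := (le_poleOrder (p := p) (h := h) h0).trans hpole
    rw [zero_mul, add_zero] at this
    exact Nat.le_of_mul_le_mul_left (by rwa [mul_one]) hp.pos
  refine ⟨(q.coeff 0).coeff 1, (q.coeff 0).coeff 0, ?_⟩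
  rw [hqx, h1, aeval_C, algebraMap_eq_aeval_x, coeff_C_zero]
  conv_lhs => rw [eq_X_add_C_of_natDegree_le_one h2]
  simp

/-- The pole order p^h + 1 excludes y² and leaves no room for a nonconstant coefficient of y. -/
lemma IsAtInfinity.exists_apply_y_eq (hO : R.IsAtInfinity O) (hh : 1 ≤ h)
    {e : R.FunctionField ≃ₐ[k] R.FunctionField} (he : e • O = O) :
    ∃ (d : k) (B : k[X]), e R.y = algebraMap k _ d * R.y + aeval R.x B := by
  have hp := (Fact.out : p.Prime)
  obtain ⟨q, -, hqy, hpole⟩ := hO.exists_apply_eq hh he _ (hO.valuation_y_eq hh)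
    fun _ _ hy => hy
  have hph : 0 < p ^ h := pow_pos hp.pos h
  have h1 : q.natDegree ≤ 1 := by
    refine natDegree_le_iff_coeff_eq_zero.2 fun i hi => ?_
    by_contra h0
    have := (le_poleOrder (p := p) (h := h) h0).trans hpole
    have : 2 * (p ^ h + 1) ≤ i * (p ^ h + 1) := Nat.mul_le_mul_right _ hi
    omega
  have h2 : (q.coeff 1).natDegree = 0 := by
    by_cases h0 : q.coeff 1 = 0
    · simp [h0]
    have := (le_poleOrder (p := p) (h := h) h0).trans hpole
    rw [one_mul] at this
    exact (Nat.mul_eq_zero.1 (by omega)).resolve_left hp.ne_zero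
  refine ⟨(q.coeff 1).coeff 0, q.coeff 0, ?_⟩
  rw [hqy]
  conv_lhs => rw [eq_X_add_C_of_natDegree_le_one h1, eq_C_of_natDegree_eq_zero h2]
  simp [algebraMap_eq_aeval_x]

/-- The multipliers of an automorphism of order `n` are `n`-th roots of unity. -/
lemma pow_eq_one_of_pow_eq_one {e : R.FunctionField ≃ₐ[k] R.FunctionField} {a b d : k} {B : k[X]}
    (hx : e R.x = algebraMap k _ a * R.x + algebraMap k _ b)
    (hy : e R.y = algebraMap k _ d * R.y + aeval R.x B) {n : ℕ} (hn : e ^ n = 1) :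
    a ^ n = 1 ∧ d ^ n = 1 := by
  have hx' : ∀ m, ∃ b' : k, (e ^ m) R.x = algebraMap k _ (a ^ m) * R.x + algebraMap k _ b' := by
    intro m
    induction m with
    | zero => exact ⟨0, by simp⟩
    | succ m ih =>
      obtain ⟨b', hb'⟩ := ih
      refine ⟨a ^ m * b + b', ?_⟩
      rw [pow_succ', AlgEquiv.mul_apply, hb', map_add, map_mul, AlgEquiv.commutes,
        AlgEquiv.commutes, hx, map_add, map_mul, pow_succ, map_mul]
      ring
  have hy' : ∀ m, ∃ B' : k[X], (e ^ m) R.y = algebraMap k _ (d ^ m) * R.y + aeval R.x B' := by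
    intro m
    induction m with
    | zero => exact ⟨0, by simp⟩
    | succ m ih =>
      obtain ⟨B', hB'⟩ := ih
      have h1 : e (aeval R.x B') = aeval R.x (B'.comp (C a * X + C b)) := by
        rw [aeval_comp, ← aeval_algHom_apply e, hx]
        simp
      refine ⟨C (d ^ m) * B + B'.comp (C a * X + C b), ?_⟩
      rw [pow_succ', AlgEquiv.mul_apply, hB', map_add, map_mul, AlgEquiv.commutes, h1, hy, map_add,
        map_mul, pow_succ, map_mul, aeval_C]
      ring
  obtain ⟨b', hb'⟩ := hx' n
  obtain ⟨B', hB'⟩ := hy' n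
  rw [hn, AlgEquiv.one_apply] at hb' hB'
  generalize a ^ n = a' at hb' ⊢
  generalize d ^ n = d' at hB' ⊢
  constructor
  · have h1 : (C a' * X + C b' : k[X]) = X := R.aeval_x_injective (by simpa using hb'.symm)
    simpa using congrArg (fun f => coeff f 1) h1
  · have hp := (Fact.out : p.Prime).one_lt
    have h1 : C (C d' - 1 : k[X]) * X + C B' = 0 := by
      refine R.eq_zero_of_aeval_y_eq_zero (natDegree_linear_le.trans_lt hp) ?_
      simp only [map_add, map_mul, aeval_C, aeval_X, algebraMap_eq_aeval_x, map_sub, map_one]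
      linear_combination -hB'
    have h2 := congrArg (fun f => coeff (coeff f 1) 0) h1
    simpa [sub_eq_zero] using h2

end Stabilizer

end AdditivePoly

/-! ### Groups generated by two elements with central commutator -/

section CentralCommutator

variable {G : Type*} [Group G] {s t : G}

/-- Conjugation by s multiplies t by the central commutator, so exchanging powers costs a power
bilinear in the exponents. This collection rule yields the normal form s^a t^b [s, t]^c. -/
lemma zpow_mul_zpow_of_commute_commutatorElement (hs : Commute ⁅s, t⁆ s) (ht : Commute ⁅s, t⁆ t)
    (a b : ℤ) : t ^ b * s ^ a = s ^ a * t ^ b * ⁅s, t⁆ ^ (-(a * b)) := by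
  have h1 : s * t * s⁻¹ = ⁅s, t⁆ * t := by rw [commutatorElement_def]; group
  have h2 : s * t ^ b * s⁻¹ = ⁅s, t⁆ ^ b * t ^ b := by
    rw [← conj_zpow, h1, ht.mul_zpow]
  have h3 : t ^ b * s * (t ^ b)⁻¹ = ⁅s, t⁆ ^ (-b) * s := by
    rw [mul_inv_eq_iff_eq_mul] at h2 ⊢
    rw [mul_assoc, h2, zpow_neg]
    group
  have h4 : t ^ b * s ^ a * (t ^ b)⁻¹ = ⁅s, t⁆ ^ (-(a * b)) * s ^ a := by
    rw [← conj_zpow, h3, (hs.zpow_left _).mul_zpow, ← zpow_mul]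
    congr 2; ring
  rw [mul_inv_eq_iff_eq_mul] at h4
  rw [h4, mul_assoc]
  exact (((hs.zpow_left _).zpow_right a).mul_right ((ht.zpow_left _).zpow_right b)).eq

lemma exists_eq_zpow_mul_zpow_mul_zpow (hs : Commute ⁅s, t⁆ s) (ht : Commute ⁅s, t⁆ t) {g : G}
    (hg : g ∈ Subgroup.closure {s, t}) :
    ∃ a b c : ℤ, g = s ^ a * t ^ b * ⁅s, t⁆ ^ c := by
  have hz : ∀ a b c : ℤ, Commute (⁅s, t⁆ ^ c) (s ^ a * t ^ b) := fun a b c =>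
    ((hs.zpow_left c).zpow_right a).mul_right ((ht.zpow_left c).zpow_right b)
  have key := zpow_mul_zpow_of_commute_commutatorElement hs ht
  induction hg using Subgroup.closure_induction with
  | mem g hg =>
    rcases hg with rfl | rfl
    · exact ⟨1, 0, 0, by simp⟩
    · exact ⟨0, 1, 0, by simp⟩
  | one => exact ⟨0, 0, 0, by simp⟩
  | mul g g' _ _ hg hg' =>
    obtain ⟨a, b, c, rfl⟩ := hg
    obtain ⟨a', b', c', rfl⟩ := hg'
    refine ⟨a + a', b + b', -(a' * b) + c + c', ?_⟩
    have h1 := (hz a' b' c).eq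
    have h2 := key a' b
    have h3 := ((ht.zpow_left (-(a' * b))).zpow_right b').eq
    calc s ^ a * t ^ b * ⁅s, t⁆ ^ c * (s ^ a' * t ^ b' * ⁅s, t⁆ ^ c')
        = s ^ a * t ^ b * (⁅s, t⁆ ^ c * (s ^ a' * t ^ b')) * ⁅s, t⁆ ^ c' := by simp only [mul_assoc]
      _ = s ^ a * (t ^ b * s ^ a') * t ^ b' * ⁅s, t⁆ ^ c * ⁅s, t⁆ ^ c' := by
        rw [h1]; simp only [mul_assoc]
      _ = s ^ a * s ^ a' * t ^ b * (⁅s, t⁆ ^ (-(a' * b)) * t ^ b') * ⁅s, t⁆ ^ c * ⁅s, t⁆ ^ c' := by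
        rw [h2]; simp only [mul_assoc]
      _ = _ := by
        rw [h3]; simp only [zpow_add, mul_assoc]
  | inv g _ hg =>
    obtain ⟨a, b, c, rfl⟩ := hg
    refine ⟨-a, -b, -(-a * -b) - c, ?_⟩
    rw [mul_inv_rev, mul_inv_rev, ← zpow_neg, ← zpow_neg, ← zpow_neg, key, sub_eq_add_neg,
      zpow_add]
    exact ((hz _ _ _).mul_right ((Commute.refl _).zpow_zpow _ _)).eq.trans (mul_assoc _ _ _)

/-- An element `s^a t^b z^c` with `z = [s, t]` of order `p` which commutes with `s` and `t`
has exponents `a` and `b` divisible by `p`. -/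
lemma dvd_of_commute_zpow_mul_zpow_mul_zpow (hs : Commute ⁅s, t⁆ s) (ht : Commute ⁅s, t⁆ t)
    {a b c : ℤ} (h1 : Commute s (s ^ a * t ^ b * ⁅s, t⁆ ^ c))
    (h2 : Commute t (s ^ a * t ^ b * ⁅s, t⁆ ^ c)) :
    (orderOf ⁅s, t⁆ : ℤ) ∣ a ∧ (orderOf ⁅s, t⁆ : ℤ) ∣ b := by
  have key := zpow_mul_zpow_of_commute_commutatorElement hs ht
  have h3 : Commute s (t ^ b) := by
    have := ((((Commute.refl s).zpow_right (-a)).mul_right h1).mul_right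
      (hs.symm.zpow_right (-c)))
    simpa only [zpow_neg, mul_assoc, inv_mul_cancel_left, mul_inv_cancel, mul_one] using this
  have h4 : Commute t (s ^ a) := by
    have := ((h2.mul_right (ht.symm.zpow_right (-c))).mul_right
      ((Commute.refl t).zpow_right (-b)))
    simpa only [zpow_neg, mul_assoc, mul_inv_cancel_left, mul_inv_cancel, mul_one] using this
  constructor
  · have := key a 1
    rw [zpow_one, h4.eq, eq_comm, mul_eq_left] at this
    rw [orderOf_dvd_iff_zpow_eq_one]
    simpa using this
  · have := key 1 b
    rw [zpow_one, ← h3.eq, eq_comm, mul_eq_left] at this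
    rw [orderOf_dvd_iff_zpow_eq_one]
    simpa using this

end CentralCommutator

/-! ### The group `E(p³)` -/

namespace ExtraspecialP3

variable {p : ℕ}

lemma u_pow (p : ℕ) : u p ^ p = 1 :=
  PresentedGroup.one_of_mem (rels := extraspecialRels p) (by simp [extraspecialRels])

lemma v_pow (p : ℕ) : v p ^ p = 1 :=
  PresentedGroup.one_of_mem (rels := extraspecialRels p) (by simp [extraspecialRels])

lemma commutator_pow (p : ℕ) : ⁅u p, v p⁆ ^ p = 1 :=
  PresentedGroup.one_of_mem (rels := extraspecialRels p)
    (x := ⁅FreeGroup.of false, FreeGroup.of true⁆ ^ p) (by simp [extraspecialRels])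

lemma commute_commutator_u (p : ℕ) : Commute ⁅u p, v p⁆ (u p) :=
  commutatorElement_eq_one_iff_commute.1 (PresentedGroup.one_of_mem (rels := extraspecialRels p)
    (x := ⁅⁅FreeGroup.of false, FreeGroup.of true⁆, FreeGroup.of false⁆)
    (by simp [extraspecialRels]))

lemma commute_commutator_v (p : ℕ) : Commute ⁅u p, v p⁆ (v p) :=
  commutatorElement_eq_one_iff_commute.1 (PresentedGroup.one_of_mem (rels := extraspecialRels p)
    (x := ⁅⁅FreeGroup.of false, FreeGroup.of true⁆, FreeGroup.of true⁆)
    (by simp [extraspecialRels]))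

lemma closure_u_v (p : ℕ) : Subgroup.closure {u p, v p} = ⊤ := by
  rw [← PresentedGroup.closure_range_of (extraspecialRels p)]
  congr 1
  ext g
  simp [u, v]

lemma exists_eq (g : ExtraspecialP3 p) :
    ∃ a b c : ℤ, g = u p ^ a * v p ^ b * ⁅u p, v p⁆ ^ c :=
  exists_eq_zpow_mul_zpow_mul_zpow (commute_commutator_u p) (commute_commutator_v p)
    (by rw [closure_u_v]; trivial)

lemma zpow_eq_one_of_dvd {G : Type*} [Group G] {g : G} (hg : g ^ p = 1) {a : ℤ}
    (ha : (p : ℤ) ∣ a) : g ^ a = 1 := by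
  obtain ⟨m, rfl⟩ := ha
  rw [zpow_mul, zpow_natCast, hg, one_zpow]

section Lift

variable {G : Type*} [Group G] {s t : G}

/-- The homomorphism from `E(p³)` given by two elements which satisfy the relations. -/
def lift (hsp : s ^ p = 1) (htp : t ^ p = 1) (hzp : ⁅s, t⁆ ^ p = 1) (hs : Commute ⁅s, t⁆ s)
    (ht : Commute ⁅s, t⁆ t) : ExtraspecialP3 p →* G :=
  PresentedGroup.toGroup (f := fun b => cond b t s) (by
    rintro r (rfl | rfl | rfl | rfl | rfl)
    · simpa using hsp
    · simpa using htp
    · simpa [map_commutatorElement] using hzp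
    · simpa [map_commutatorElement] using commutatorElement_eq_one_iff_commute.2 hs
    · simpa [map_commutatorElement] using commutatorElement_eq_one_iff_commute.2 ht)

variable (hsp : s ^ p = 1) (htp : t ^ p = 1) (hzp : ⁅s, t⁆ ^ p = 1) (hs : Commute ⁅s, t⁆ s)
    (ht : Commute ⁅s, t⁆ t)

lemma lift_u : lift hsp htp hzp hs ht (u p) = s := by
  simp [lift, u]

lemma lift_v : lift hsp htp hzp hs ht (v p) = t := by
  simp [lift, v]

lemma lift_commutator : lift hsp htp hzp hs ht ⁅u p, v p⁆ = ⁅s, t⁆ := by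
  rw [map_commutatorElement, lift_u, lift_v]

lemma lift_range : (lift hsp htp hzp hs ht).range = Subgroup.closure {s, t} := by
  rw [MonoidHom.range_eq_map, ← closure_u_v, MonoidHom.map_closure, Set.image_pair, lift_u, lift_v]

/-- A normal form mapping to 1 commutes with s and t, so p divides the exponents of u and v; what
remains is a power of [s, t], of order p. -/
lemma lift_injective [Fact p.Prime] (hz : ⁅s, t⁆ ≠ 1) :
    Function.Injective (lift hsp htp hzp hs ht) := by
  rw [injective_iff_map_eq_one]
  intro g hg
  obtain ⟨a, b, c, rfl⟩ := exists_eq g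
  rw [map_mul, map_mul, map_zpow, map_zpow, map_zpow, lift_u, lift_v, lift_commutator] at hg
  have ho : orderOf ⁅s, t⁆ = p := orderOf_eq_prime hzp hz
  obtain ⟨ha, hb⟩ := dvd_of_commute_zpow_mul_zpow_mul_zpow hs ht (a := a) (b := b) (c := c)
    (by rw [hg]; exact Commute.one_right _) (by rw [hg]; exact Commute.one_right _)
  rw [ho] at ha hb
  rw [zpow_eq_one_of_dvd hsp ha, zpow_eq_one_of_dvd htp hb, one_mul, one_mul,
    ← orderOf_dvd_iff_zpow_eq_one, ho] at hg
  rw [zpow_eq_one_of_dvd (u_pow p) ha, zpow_eq_one_of_dvd (v_pow p) hb,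
    zpow_eq_one_of_dvd (commutator_pow p) hg, one_mul, one_mul]

end Lift

section Center

variable [Fact p.Prime] (hw : ⁅u p, v p⁆ ≠ 1)

include hw

lemma orderOf_commutator : orderOf ⁅u p, v p⁆ = p := orderOf_eq_prime (commutator_pow p) hw

lemma exists_eq_zpow_of_mem_center {g : ExtraspecialP3 p} (hg : g ∈ Subgroup.center _) :
    ∃ c : ℤ, g = ⁅u p, v p⁆ ^ c := by
  obtain ⟨a, b, c, rfl⟩ := exists_eq g
  obtain ⟨ha, hb⟩ := dvd_of_commute_zpow_mul_zpow_mul_zpow (commute_commutator_u p)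
    (commute_commutator_v p) (Subgroup.mem_center_iff.1 hg _) (Subgroup.mem_center_iff.1 hg _)
  rw [orderOf_commutator hw] at ha hb
  exact ⟨c, by rw [zpow_eq_one_of_dvd (u_pow p) ha, zpow_eq_one_of_dvd (v_pow p) hb, one_mul,
    one_mul]⟩

/-- In the normal form, the exponents of u and v are detected modulo p by the two homomorphisms to
ℤ/p, and the third by the order of the commutator. That the commutator is nontrivial is an
assumption here; it is later verified through a map to P. -/
lemma card_eq : Nat.card (ExtraspecialP3 p) = p ^ 3 := by
  have hp0 : (p : ℤ) ≠ 0 := by exact_mod_cast (Fact.out : p.Prime).ne_zero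
  let f : Fin p × Fin p × Fin p → ExtraspecialP3 p := fun x =>
    u p ^ (x.1 : ℕ) * v p ^ (x.2.1 : ℕ) * ⁅u p, v p⁆ ^ (x.2.2 : ℕ)
  have hinj : Function.Injective f := by
    have ab : ∀ s t : Multiplicative (ZMod p), ⁅s, t⁆ = 1 := fun s t =>
      commutatorElement_eq_one_iff_commute.2 (Commute.all s t)
    have hpow : ∀ s : Multiplicative (ZMod p), s ^ p = 1 := fun s => by
      rw [← ofAdd_toAdd s, ← ofAdd_nsmul]; simp
    let φ (s t : Multiplicative (ZMod p)) : ExtraspecialP3 p →* Multiplicative (ZMod p) :=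
      lift (hpow s) (hpow t) (hpow _) (Commute.all _ _) (Commute.all _ _)
    have key : ∀ m n : Fin p, ((m : ℕ) : ZMod p) = (n : ℕ) → m = n := by
      intro m n hmn
      rw [ZMod.natCast_eq_natCast_iff'] at hmn
      rw [Nat.mod_eq_of_lt m.2, Nat.mod_eq_of_lt n.2] at hmn
      exact Fin.ext hmn
    rintro ⟨a, b, c⟩ ⟨a', b', c'⟩ hx
    have hu := congrArg (fun g => (φ (Multiplicative.ofAdd 1) 1 g).toAdd) hx
    have hv := congrArg (fun g => (φ 1 (Multiplicative.ofAdd 1) g).toAdd) hx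
    simp only [f, φ, map_mul, map_pow, lift_u, lift_v, lift_commutator, ab, one_pow, mul_one,
      toAdd_pow, toAdd_ofAdd, nsmul_one, one_mul] at hu hv
    obtain rfl := key _ _ hu
    obtain rfl := key _ _ hv
    have hc := mul_left_cancel hx
    have : c = c' := Fin.ext (pow_injOn_Iio_orderOf (by simp [orderOf_commutator hw])
      (by simp [orderOf_commutator hw]) hc)
    rw [this]
  have hsurj : Function.Surjective f := by
    intro g
    obtain ⟨a, b, c, rfl⟩ := exists_eq g
    have key : ∀ {g : ExtraspecialP3 p}, g ^ p = 1 → ∀ a : ℤ, ∃ m : Fin p, g ^ (m : ℕ) = g ^ a := by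
      intro g hg a
      refine ⟨⟨(a % p).toNat, ?_⟩, ?_⟩
      · have := Int.emod_nonneg a hp0
        have := Int.emod_lt_of_pos a (b := p) (by omega)
        omega
      · rw [← zpow_natCast, Int.toNat_of_nonneg (Int.emod_nonneg a hp0)]
        conv_rhs => rw [← Int.emod_add_mul_ediv a p, zpow_add,
          zpow_eq_one_of_dvd hg (dvd_mul_right _ _), mul_one]
    obtain ⟨a', ha⟩ := key (u_pow p) a
    obtain ⟨b', hb⟩ := key (v_pow p) b
    obtain ⟨c', hc⟩ := key (commutator_pow p) c
    exact ⟨(a', b', c'), by simp only [f, ha, hb, hc]⟩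
  rw [← Nat.card_eq_of_bijective f ⟨hinj, hsurj⟩]
  simp only [Nat.card_prod, Nat.card_fin]
  ring

end Center

end ExtraspecialP3

/-! ### Central products -/

section CentralProduct

variable {p : ℕ} [Fact p.Prime] {G : Type*} [Group G] {ι : Type*} [Fintype ι] [DecidableEq ι]

open scoped IsMulCommutative in
/-- A homomorphism from a direct power `E^ι` which is injective on every factor and which restricts
to the same homomorphism on the centres of all the factors has kernel `centralKernel ι E`. -/
lemma ker_eq_centralKernel {E : Type*} [Group E] (ψ : (ι → E) →* G) (i₀ : ι)
    (hinj : ∀ i, Function.Injective fun g => ψ (Pi.mulSingle i g))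
    (hcenter : ∀ i, ∀ g ∈ Subgroup.center E, ψ (Pi.mulSingle i g) = ψ (Pi.mulSingle i₀ g)) :
    ψ.ker = centralKernel ι E := by
  -- On families of central elements ψ depends only on the product of the entries. Both sides are
  -- homomorphisms, so it suffices to check families with a single nontrivial entry.
  have hprod : ∀ w : ι → Subgroup.center E,
      ψ (fun i => (w i : E)) = ψ (Pi.mulSingle i₀ ((∏ i, w i : Subgroup.center E) : E)) := by
    let χ : (ι → Subgroup.center E) →* G :=
      ψ.comp (MonoidHom.compLeft (Subgroup.center E).subtype ι)
    let f₀ : Subgroup.center E →* G :=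
      (ψ.comp (MonoidHom.mulSingle (fun _ => E) i₀)).comp (Subgroup.center E).subtype
    let π : (ι → Subgroup.center E) →* Subgroup.center E :=
      { toFun := fun w => ∏ i, w i
        map_one' := by simp
        map_mul' := fun w w' => by simp [Finset.prod_mul_distrib] }
    let χ' : (ι → Subgroup.center E) →* G := f₀.comp π
    have : χ = χ' := by
      refine MonoidHom.pi_ext fun i g => ?_
      have h1 : χ (Pi.mulSingle i g) = ψ (Pi.mulSingle i (g : E)) := by
        change ψ _ = _
        congr 1
        ext j
        rcases eq_or_ne j i with rfl | hj <;> simp [*]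
      have h2 : χ' (Pi.mulSingle i g) = ψ (Pi.mulSingle i₀ (g : E)) := by
        change ψ (Pi.mulSingle i₀ ((∏ j, (Pi.mulSingle i g : ι → Subgroup.center E) j :
          Subgroup.center E) : E)) = _
        rw [Finset.prod_pi_mulSingle']
        simp
      exact h1.trans ((hcenter i g g.2).trans h2.symm)
    exact fun w => DFunLike.congr_fun this w
  ext x
  rw [MonoidHom.mem_ker]
  constructor
  · intro hx
    -- The commutator of `x` with an element e of the j-th factor is [e, x_j] in that factor. It
    -- lies in the kernel, and ψ is injective on the factor.
    have hmem : ∀ j, x j ∈ Subgroup.center E := by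
      intro j
      rw [Subgroup.mem_center_iff]
      intro e
      refine commutatorElement_eq_one_iff_mul_comm.1 (hinj j ?_)
      have h1 : (Pi.mulSingle j ⁅e, x j⁆ : ι → E) = ⁅(Pi.mulSingle j e : ι → E), x⁆ := by
        ext i
        rcases eq_or_ne i j with rfl | hij
        · simp [commutatorElement_def]
        · simp [commutatorElement_def, hij]
      simp only
      rw [h1, map_commutatorElement, hx]
      simp
    refine ⟨fun i => ⟨x i, hmem i⟩, fun i => rfl, ?_⟩
    have h1 := hprod fun i => ⟨x i, hmem i⟩
    have h2 := hinj i₀ (a₁ := ((∏ i, ⟨x i, hmem i⟩ : Subgroup.center E) : E)) (a₂ := 1)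
      (by simp only; rw [← h1, Pi.mulSingle_one, map_one]; exact hx)
    exact Subtype.ext h2
  · rintro ⟨w, hw, hw1⟩
    obtain rfl : x = fun i => (w i : E) := funext hw
    rw [hprod, hw1]
    simp

/-- A group of exponent dividing `p` whose centre is generated by `z ≠ 1`, and which is generated by
commuting pairs `s i`, `s' i` with `[s i, s' i] = z`, is the central product of copies of `E(p³)`. -/
theorem exists_centralPower_mulEquiv [Nonempty ι] (hexp : ∀ g : G, g ^ p = 1) {z : G} (hz : z ≠ 1)
    (hcenter : Subgroup.center G = Subgroup.zpowers z) {s s' : ι → G}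
    (hss' : ∀ i, ⁅s i, s' i⁆ = z)
    (hcomm : ∀ i j, i ≠ j → Commute (s i) (s j) ∧ Commute (s i) (s' j) ∧ Commute (s' i) (s' j))
    (htop : ⨆ i, Subgroup.closure {s i, s' i} = ⊤) :
    IsCentralProduct (fun i => Subgroup.closure {s i, s' i}) ∧
      (∀ i, Nonempty (Subgroup.closure {s i, s' i} ≃* ExtraspecialP3 p)) ∧
      ∃ Φ : CentralPower ι (ExtraspecialP3 p) ≃* G, ∀ i,
        Φ (CentralPower.single i (ExtraspecialP3.u p)) = s i ∧
        Φ (CentralPower.single i (ExtraspecialP3.v p)) = s' i := by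
  have hzc : ∀ g, Commute z g := fun g => by
    have : z ∈ Subgroup.center G := hcenter ▸ Subgroup.mem_zpowers z
    exact (Subgroup.mem_center_iff.1 this g).symm
  let φ : ∀ _ : ι, ExtraspecialP3 p →* G := fun i => ExtraspecialP3.lift (hexp (s i)) (hexp (s' i))
    (hexp _) (by rw [hss']; exact hzc _) (by rw [hss']; exact hzc _)
  have hφu : ∀ i, φ i (ExtraspecialP3.u p) = s i := fun i => ExtraspecialP3.lift_u ..
  have hφv : ∀ i, φ i (ExtraspecialP3.v p) = s' i := fun i => ExtraspecialP3.lift_v ..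
  have hφw : ∀ i, φ i ⁅ExtraspecialP3.u p, ExtraspecialP3.v p⁆ = z := fun i =>
    (ExtraspecialP3.lift_commutator ..).trans (hss' i)
  have hφ : ∀ i, Function.Injective (φ i) := fun i =>
    ExtraspecialP3.lift_injective _ _ _ _ _ (by rw [hss']; exact hz)
  have hrange : ∀ i, (φ i).range = Subgroup.closure {s i, s' i} := fun i =>
    ExtraspecialP3.lift_range ..
  have hw : ⁅ExtraspecialP3.u p, ExtraspecialP3.v p⁆ ≠ 1 := fun h0 => by
    have := hφw (Classical.arbitrary ι)
    rw [h0, map_one] at this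
    exact hz this.symm
  have hcl : ∀ i j, i ≠ j → ∀ g ∈ Subgroup.closure {s i, s' i},
      ∀ g' ∈ Subgroup.closure {s j, s' j}, Commute g g' := by
    intro i j hij g hg g' hg'
    have h1 : Subgroup.closure {s i, s' i} ≤ Subgroup.centralizer {s j, s' j} := by
      rw [Subgroup.closure_le]
      rintro _ (rfl | rfl)
      · rintro _ (rfl | rfl)
        exacts [(hcomm i j hij).1.symm, (hcomm i j hij).2.1.symm]
      · rintro _ (rfl | rfl)
        exacts [(hcomm j i hij.symm).2.1, (hcomm i j hij).2.2.symm]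
    have h2 : Subgroup.closure {s j, s' j} ≤ Subgroup.centralizer {g} := by
      rw [Subgroup.closure_le]
      intro x hx
      rintro _ rfl
      exact (h1 hg x hx).symm
    exact h2 hg' g rfl
  have hpair : Pairwise fun i j => ∀ x y, Commute (φ i x) (φ j y) := fun i j hij x y =>
    hcl i j hij _ (hrange i ▸ ⟨x, rfl⟩) _ (hrange j ▸ ⟨y, rfl⟩)
  let ψ := MonoidHom.noncommPiCoprod φ hpair
  have hψ : ∀ i g, ψ (Pi.mulSingle i g) = φ i g := fun i g =>
    MonoidHom.noncommPiCoprod_mulSingle ..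
  have hker : ψ.ker = centralKernel ι (ExtraspecialP3 p) := by
    refine ker_eq_centralKernel ψ (Classical.arbitrary ι) (fun i => ?_) fun i g hg => ?_
    · simpa only [hψ] using hφ i
    · obtain ⟨c, rfl⟩ := ExtraspecialP3.exists_eq_zpow_of_mem_center hw hg
      rw [hψ, hψ, map_zpow, map_zpow, hφw, hφw]
  have hsurj : Function.Surjective ψ := by
    rw [← MonoidHom.range_eq_top, MonoidHom.noncommPiCoprod_range]
    simpa only [hrange] using htop
  refine ⟨⟨htop, hcl, fun i => le_antisymm ?_ ?_⟩, fun i => ?_, ?_⟩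
  -- A central element of one factor commutes with that factor and with all the others, hence with
  -- G. Conversely the generator z of the centre is the commutator of the pair generating the
  -- factor.
  · rintro _ ⟨⟨g, hg⟩, hgc, rfl⟩
    rw [Subgroup.mem_center_iff]
    have h1 : (⊤ : Subgroup G) ≤ Subgroup.centralizer {g} := by
      rw [← htop, iSup_le_iff]
      intro j x hx
      rintro _ rfl
      rcases eq_or_ne i j with rfl | hij
      · exact (congrArg Subtype.val (Subgroup.mem_center_iff.1 hgc ⟨x, hx⟩)).symm
      · exact hcl i j hij _ hg _ hx
    exact fun x => (h1 (Subgroup.mem_top x) g rfl).symm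
  · rw [hcenter, Subgroup.zpowers_le]
    have hmem : z ∈ Subgroup.closure {s i, s' i} := by
      rw [← hss' i, commutatorElement_def]
      have h1 : s i ∈ Subgroup.closure {s i, s' i} := Subgroup.subset_closure (by simp)
      have h2 : s' i ∈ Subgroup.closure {s i, s' i} := Subgroup.subset_closure (by simp)
      exact mul_mem (mul_mem (mul_mem h1 h2) (inv_mem h1)) (inv_mem h2)
    exact ⟨⟨z, hmem⟩, Subgroup.mem_center_iff.2 fun x => Subtype.ext (hzc x).symm.eq, rfl⟩
  · rw [← hrange i]
    exact ⟨(MonoidHom.ofInjective (hφ i)).symm⟩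
  · let Φ : CentralPower ι (ExtraspecialP3 p) ≃* G :=
      (QuotientGroup.quotientMulEquivOfEq hker.symm).trans
        (QuotientGroup.quotientKerEquivOfSurjective ψ hsurj)
    have hΦ : ∀ i g, Φ (CentralPower.single i g) = φ i g := fun i g => hψ i g
    exact ⟨Φ, fun i => ⟨(hΦ i _).trans (hφu i), (hΦ i _).trans (hφv i)⟩⟩

/-- `E(p³)` has order `p³` and exponent `p` and is not abelian, provided that it maps to some group
of exponent dividing `p` with noncommuting images of the generators and central commutator. -/
theorem extraspecialP3_properties (hexp : ∀ g : G, g ^ p = 1) {s t : G} (hz : ⁅s, t⁆ ≠ 1)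
    (hzc : ∀ g, Commute ⁅s, t⁆ g) :
    Nat.card (ExtraspecialP3 p) = p ^ 3 ∧ Monoid.exponent (ExtraspecialP3 p) = p ∧
      ¬ Commute (ExtraspecialP3.u p) (ExtraspecialP3.v p) := by
  let φ := ExtraspecialP3.lift (hexp s) (hexp t) (hexp _) (hzc _) (hzc _)
  have hφ : Function.Injective φ := ExtraspecialP3.lift_injective _ _ _ _ _ hz
  have hw : ⁅ExtraspecialP3.u p, ExtraspecialP3.v p⁆ ≠ 1 := fun h0 => hz (by
    rw [← ExtraspecialP3.lift_commutator (hexp s) (hexp t) (hexp _) (hzc _) (hzc _), h0, map_one])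
  refine ⟨ExtraspecialP3.card_eq hw, ?_, fun h0 =>
    hw (commutatorElement_eq_one_iff_commute.2 h0)⟩
  refine ((Fact.out : p.Prime).eq_one_or_self_of_dvd _
    (Monoid.exponent_dvd_of_forall_pow_eq_one fun g => hφ ?_)).resolve_left fun h1 => hw ?_
  · rw [map_pow, hexp, map_one]
  · simpa [h1] using Monoid.pow_exponent_eq_one ⁅ExtraspecialP3.u p, ExtraspecialP3.v p⁆

end CentralProduct

/-! ### Symplectic bases -/

section Symplectic

variable {F V : Type*} [Field F] [AddCommGroup V] [Module F V]

/-- Hyperbolic pairs are split off one at a time: orthogonality to the m pairs already found imposes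
2m < 2n linear conditions, so a nonzero vector e remains, and its partner can be made orthogonal to
them. -/
lemma exists_symplectic_family [FiniteDimensional F V] {ε : LinearMap.BilinForm F V}
    (halt : ε.IsAlt) (hnd : ε.Nondegenerate) {n : ℕ} (hn : Module.finrank F V = 2 * n) (m : ℕ)
    (hm : m ≤ n) : ∃ c c' : Fin m → V, ∀ i j, ε (c i) (c j) = 0 ∧ ε (c' i) (c' j) = 0 ∧
      ε (c i) (c' j) = if i = j then 1 else 0 := by
  induction m with
  | zero => exact ⟨Fin.elim0, Fin.elim0, fun i => i.elim0⟩
  | succ m ih =>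
    obtain ⟨c, c', hc⟩ := ih (by omega)
    have hneg : ∀ x y, ε x y = -ε y x := fun x y => (halt.neg_eq y x).symm
    obtain ⟨e, he, he0⟩ : ∃ e : V, (∀ i, ε (c i) e = 0 ∧ ε (c' i) e = 0) ∧ e ≠ 0 := by
      let L : V →ₗ[F] (Fin m ⊕ Fin m → F) :=
        LinearMap.pi fun i => ε (Sum.elim c c' i)
      have : LinearMap.ker L ≠ ⊥ := LinearMap.ker_ne_bot_of_finrank_lt (by
        rw [Module.finrank_fintype_fun_eq_card, Fintype.card_sum, Fintype.card_fin]
        omega)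
      obtain ⟨e, he, he0⟩ := Submodule.exists_mem_ne_zero_of_ne_bot this
      exact ⟨e, fun i => ⟨congrFun (LinearMap.mem_ker.1 he) (.inl i),
        congrFun (LinearMap.mem_ker.1 he) (.inr i)⟩, he0⟩
    obtain ⟨g, hg⟩ : ∃ g, ε e g = 1 := by
      obtain ⟨g, hg⟩ : ∃ g, ε e g ≠ 0 := by
        by_contra! h0
        exact he0 (hnd.1 e h0)
      exact ⟨(ε e g)⁻¹ • g, by rw [map_smul, smul_eq_mul, inv_mul_cancel₀ hg]⟩
    -- Subtract the projection of g to the span of the earlier pairs. The signs differ because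
    -- ε(c'_i, c_i) = −1; the value ε(e, g) = 1 is unchanged since e is orthogonal to that span.
    let f := g - ∑ i, ε (c i) g • c' i + ∑ i, ε (c' i) g • c i
    have hf : ∀ i, ε (c i) f = 0 ∧ ε (c' i) f = 0 := by
      intro i
      have h1 : ∀ j, ε (c' i) (c j) = if i = j then -1 else 0 := fun j => by
        rw [hneg, (hc j i).2.2]
        by_cases hij : i = j
        · rw [if_pos hij, if_pos hij.symm]
        · rw [if_neg hij, if_neg (Ne.symm hij), neg_zero]
      constructor <;>
        simp only [f, map_add, map_sub, map_sum, map_smul, smul_eq_mul, (hc i _).1, (hc i _).2.1,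
          (hc i _).2.2, h1] <;> simp
    have hef : ε e f = 1 := by
      have h1 : ∀ j, ε e (c j) = 0 ∧ ε e (c' j) = 0 := fun j => by
        rw [hneg, hneg e, (he j).1, (he j).2]; simp
      simp [f, (h1 _).1, (h1 _).2, hg]
    refine ⟨Fin.cons e c, Fin.cons f c', fun i j => ?_⟩
    refine Fin.cases ?_ (fun i => ?_) i <;> refine Fin.cases ?_ (fun j => ?_) j
    · simpa using ⟨halt e, halt f, hef⟩
    · simp only [Fin.cons_zero, Fin.cons_succ]
      rw [hneg e, hneg f, (he j).1, (hf j).2, hneg e, (he j).2]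
      simp [(Fin.succ_ne_zero j).symm]
    · simp [(he i).1, (hf i).1, (hf i).2]
    · simpa using hc i j

lemma exists_isSymplecticBasis [FiniteDimensional F V] {ε : LinearMap.BilinForm F V}
    (halt : ε.IsAlt) (hnd : ε.Nondegenerate) {n : ℕ} (hn : Module.finrank F V = 2 * n) :
    ∃ b : Module.Basis (Fin n ⊕ Fin n) F V, IsSymplecticBasis ε b := by
  obtain ⟨c, c', hc⟩ := exists_symplectic_family halt hnd hn n le_rfl
  have hneg : ∀ x y, ε x y = -ε y x := fun x y => (halt.neg_eq y x).symm
  have hli : LinearIndependent F (Sum.elim c c') := by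
    rw [Fintype.linearIndependent_iff]
    intro g hg
    rw [Fintype.sum_sum_type] at hg
    simp only [Sum.elim_inl, Sum.elim_inr] at hg
    rintro (i | i)
    · have := congrArg (fun x => ε x (c' i)) hg
      simpa [(hc _ i).2.1, (hc _ i).2.2] using this
    · have := congrArg (ε (c i)) hg
      simpa [(hc i _).1, (hc i _).2.2] using this
  refine ⟨Module.Basis.mk hli (hli.span_eq_top_of_card_eq_finrank' ?_).ge, fun i j => ?_⟩
  · rw [Fintype.card_sum, Fintype.card_fin, hn, two_mul]
  · simpa using hc i j

end Symplectic

namespace AdditivePoly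

variable {p : ℕ} {k : Type*} [Field k] {h : ℕ}
-- Pullback is contravariant; this order decides that the cocycle below is B_c(d) and not B_d(c),
-- and so fixes the sign of ε.
lemma pullback_mul {R : AdditivePoly p k h} (σ τ : R.CurveAut) (f : R.FunctionField) :
    pullback (σ * τ) f = pullback τ (pullback σ f) := rfl

variable [Fact p.Prime] [Fact (p ≠ 2)] [Algebra (ZMod p) k]

/-! ### The automorphisms `(x, y) ↦ (x + c, y + B_c(x) + β)` -/

section Translations

/-- The automorphism `σ` is `(x, y) ↦ (x + c, y + B_c(x) + β)`. -/
structure IsTranslation (R : AdditivePoly p k h) (σ : R.CurveAut) (c : R.W) (β : k) : Prop where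
  apply_x : pullback σ R.x = R.x + algebraMap k _ (c : k)
  apply_y : pullback σ R.y = R.y + aeval R.x (R.B c) + algebraMap k _ β

lemma pullback_ext {R : AdditivePoly p k h} {σ τ : R.CurveAut}
    (hx : pullback σ R.x = pullback τ R.x) (hy : pullback σ R.y = pullback τ R.y) : σ = τ := by
  have : (pullback σ : R.FunctionField →ₐ[k] R.FunctionField) = pullback τ :=
    algHom_ext hx hy
  exact MulOpposite.unop_injective (AlgEquiv.coe_toAlgHom_injective this)

variable {R : AdditivePoly p k h} {σ τ : R.CurveAut} {c d : R.W} {β γ : k}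

lemma IsTranslation.ext (hσ : R.IsTranslation σ c β) (hτ : R.IsTranslation τ c β) : σ = τ :=
  pullback_ext (hσ.apply_x.trans hτ.apply_x.symm) (hσ.apply_y.trans hτ.apply_y.symm)

lemma IsTranslation.unique (hσ : R.IsTranslation σ c β) (hσ' : R.IsTranslation σ d γ) :
    c = d ∧ β = γ := by
  have h1 := hσ.apply_x.symm.trans hσ'.apply_x
  obtain rfl : c = d :=
    Subtype.ext ((algebraMap k R.FunctionField).injective (add_left_cancel h1))
  have h2 := hσ.apply_y.symm.trans hσ'.apply_y
  exact ⟨rfl, (algebraMap k R.FunctionField).injective (add_left_cancel h2)⟩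

lemma isTranslation_one (R : AdditivePoly p k h) : R.IsTranslation 1 0 0 := by
  constructor
  · simp [pullback]
  · simp [pullback, B_zero]

/-- By additivity of B_c, replacing x by x + d adds the constant B_c(d): this is the cocycle of the
extension. -/
lemma IsTranslation.mul (hσ : R.IsTranslation σ c β) (hτ : R.IsTranslation τ d γ) :
    R.IsTranslation (σ * τ) (c + d) (β + γ + (R.B c).eval (d : k)) := by
  have : CharP k p := charP_of_injective_algebraMap (algebraMap (ZMod p) k).injective p
  constructor
  · rw [pullback_mul, hσ.apply_x, map_add, AlgEquiv.commutes, hτ.apply_x, Submodule.coe_add,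
      map_add]
    ring
  · have h1 : pullback τ (aeval R.x (R.B c)) =
        aeval R.x (R.B c) + algebraMap k _ ((R.B c).eval (d : k)) := by
      rw [← aeval_algHom_apply (pullback τ), hτ.apply_x]
      have := congrArg (aeval R.x) (R.B_comp_X_add_C c.2 d)
      simpa [aeval_comp] using this
    rw [pullback_mul, hσ.apply_y, map_add, map_add, AlgEquiv.commutes, h1, hτ.apply_y,
      Submodule.coe_add, R.B_add c.2 d.2]
    simp only [map_add]
    ring

lemma IsTranslation.pow (hσ : R.IsTranslation σ c β) (n : ℕ) :
    R.IsTranslation (σ ^ n) (n • c) (n * β + n.choose 2 * (R.B c).eval (c : k)) := by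
  induction n with
  | zero => simpa using R.isTranslation_one
  | succ n ih =>
    have h1 := hσ.mul ih
    have h2 : ((n • c : R.W) : k) = n * (c : k) := by simp
    rw [← pow_succ', ← succ_nsmul', h2, B_eval_natCast_mul] at h1
    convert h1 using 1
    rw [Nat.choose_succ_succ' n 1, Nat.choose_one_right]
    push_cast
    ring

/-- For odd p the binomial coefficient p(p − 1)/2 vanishes modulo p, which removes the quadratic
term B_c(c). -/
lemma IsTranslation.pow_prime (hσ : R.IsTranslation σ c β) : σ ^ p = 1 := by
  have : CharP k p := charP_of_injective_algebraMap (algebraMap (ZMod p) k).injective p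
  have hp : p.Prime := Fact.out
  have hp2 : 2 < p := lt_of_le_of_ne hp.two_le (Fact.out : p ≠ 2).symm
  have h1 := hσ.pow p
  have h2 : p • c = 0 := by
    rw [← Nat.cast_smul_eq_nsmul (ZMod p), CharP.cast_eq_zero, zero_smul]
  rw [h2, CharP.cast_eq_zero, (CharP.cast_eq_zero_iff k p _).2 (hp.dvd_choose_self two_ne_zero hp2),
    zero_mul, zero_mul, add_zero] at h1
  exact h1.ext R.isTranslation_one

/-- With x fixed, the equation for y leaves only β^p − β = 0. -/
lemma IsTranslation.pow_eq_self_of_zero (hσ : R.IsTranslation σ 0 β) : β ^ p = β := by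
  have h1 := congrArg (pullback σ) R.y_pow_sub
  have hx : pullback σ R.x = R.x := by simpa using hσ.apply_x
  have hy : pullback σ R.y = R.y + algebraMap k _ β := by simpa [B_zero] using hσ.apply_y
  rw [map_sub, map_pow, map_mul, ← aeval_algHom_apply (pullback σ), hx, hy, add_pow_char,
    ← R.y_pow_sub] at h1
  refine (algebraMap k R.FunctionField).injective ?_
  rw [map_pow]
  linear_combination h1

variable (R) in
lemma exists_isTranslation (c : R.W) (hβ : β ^ p - β = c * R.toPoly.eval (c : k)) :
    ∃ σ : R.CurveAut, R.IsTranslation σ c β := by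
  have : CharP k p := charP_of_injective_algebraMap (algebraMap (ZMod p) k).injective p
  have hend : ∀ (c : R.W) (β : k), β ^ p - β = c * R.toPoly.eval (c : k) →
      ∃ f : R.FunctionField →ₐ[k] R.FunctionField, f R.x = R.x + algebraMap k _ (c : k) ∧
        f R.y = R.y + aeval R.x (R.B c) + algebraMap k _ β := by
    intro c β hβ
    have hc : ∀ f : k[X], aeval (R.x + algebraMap k _ (c : k)) f =
        aeval R.x (f.comp (X + C (c : k))) := fun f => by simp [aeval_comp]
    refine R.exists_algHom (fun f g hfg => ?_) ?_
    · rw [hc, hc] at hfg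
      have h1 := congrArg (fun q : k[X] => q.comp (X - C (c : k))) (R.aeval_x_injective hfg)
      simpa [comp_assoc] using h1
    · have h1 := congrArg (aeval R.x) (R.isB_B c.2).2
      have h2 := congrArg (algebraMap k R.FunctionField) hβ
      rw [hc, R.toPoly_comp_X_add_C, add_pow_char, add_pow_char]
      simp only [map_add, map_sub, map_mul, map_pow, aeval_C, aeval_X] at h1 h2 ⊢
      linear_combination h1 + h2 + R.y_pow_sub
  obtain ⟨f, hfx, hfy⟩ := hend c β hβ
  -- The constant term of the inverse translation by −c: composing must give β + γ + B_c(−c) = 0,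
  -- and B_c(−c) = −B_c(c).
  have hg : (-β + (R.B c).eval (c : k)) ^ p - (-β + (R.B c).eval (c : k)) =
      ((-c : R.W) : k) * R.toPoly.eval ((-c : R.W) : k) := by
    have h1 := R.B_eval_pow_sub c.2 c
    have h2 := R.toPoly_eval_add c (-c)
    rw [add_neg_cancel, R.toPoly_eval_zero] at h2
    have h3 : (-β) ^ p = -β ^ p := map_neg (frobenius k p) β
    rw [add_pow_char, Submodule.coe_neg, h3]
    linear_combination h1 - hβ - (c : k) * h2
  obtain ⟨g, hgx, hgy⟩ := hend (-c) _ hg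
  have hcomp : ∀ (c d : R.W) (β γ : k) (f g : R.FunctionField →ₐ[k] R.FunctionField), c + d = 0 →
      β + γ + (R.B c).eval (d : k) = 0 → f R.x = R.x + algebraMap k _ (c : k) →
      f R.y = R.y + aeval R.x (R.B c) + algebraMap k _ β →
      g R.x = R.x + algebraMap k _ (d : k) →
      g R.y = R.y + aeval R.x (R.B d) + algebraMap k _ γ → g.comp f = AlgHom.id k _ := by
    intro c d β γ f g hcd hβγ hfx hfy hgx hgy
    have hcd' : (c : k) + d = 0 := congrArg Subtype.val hcd
    refine algHom_ext ?_ ?_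
    · have := congrArg (algebraMap k R.FunctionField) hcd'
      rw [map_add, map_zero] at this
      rw [AlgHom.comp_apply, hfx, map_add, AlgHom.commutes, hgx, AlgHom.id_apply]
      linear_combination this
    · have h1 : g (aeval R.x (R.B c)) =
          aeval R.x (R.B c) + algebraMap k _ ((R.B c).eval (d : k)) := by
        rw [← aeval_algHom_apply g, hgx]
        have := congrArg (aeval R.x) (R.B_comp_X_add_C c.2 d)
        simpa [aeval_comp] using this
      have h2 := congrArg (aeval R.x) (R.B_add c.2 d.2)
      have h3 := congrArg (algebraMap k R.FunctionField) hβγ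
      rw [hcd', B_zero, map_zero, map_add] at h2
      rw [map_add, map_add, map_zero] at h3
      rw [AlgHom.comp_apply, hfy, map_add, map_add, AlgHom.commutes, h1, hgy, AlgHom.id_apply]
      linear_combination h3 - h2
  have hneg : (R.B ((-c : R.W) : k)) = -R.B c := by
    have := R.B_add c.2 (-c).2
    rw [Submodule.coe_neg, add_neg_cancel, B_zero] at this
    rw [Submodule.coe_neg]
    linear_combination -this
  have hBneg : (R.B c).eval ((-c : R.W) : k) = -(R.B c).eval (c : k) := by
    have := R.B_eval_add c.2 c (-c)
    rw [add_neg_cancel, (R.isB_B c.2).eval_zero] at this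
    rw [Submodule.coe_neg]
    linear_combination -this
  refine ⟨MulOpposite.op (AlgEquiv.ofAlgHom f g ?_ ?_), hfx, hfy⟩
  · refine hcomp (-c) c _ β g f (neg_add_cancel c) ?_ hgx hgy hfx hfy
    rw [hneg, eval_neg]
    ring
  · refine hcomp c (-c) β _ f g (add_neg_cancel c) ?_ hfx hfy hgx hgy
    rw [hBneg]
    ring

/-- Adding a constant to x does not remove its pole, so the translated valuation ring is again at
infinity and uniqueness applies. -/
lemma IsTranslation.mem_Aut0 (hh : 1 ≤ h) (hσ : R.IsTranslation σ c β) : σ ∈ R.Aut0 := by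
  obtain ⟨O, hO⟩ := R.exists_isAtInfinity
  rw [mem_Aut0_iff hh hO, ← eq_inv_smul_iff]
  have hmem : ∀ z, z ∈ (pullback σ)⁻¹ • O ↔ pullback σ z ∈ O := fun z => by
    rw [ValuationSubring.mem_inv_pointwise_smul_iff]
    rfl
  refine hO.eq hh ⟨fun t => ?_, Or.inl fun hx => ?_⟩
  · rw [hmem, AlgEquiv.commutes]
    exact hO.1 t
  · rw [hmem, hσ.apply_x] at hx
    have h1 := sub_mem hx (hO.1 c)
    rw [add_sub_cancel_right, ← ValuationSubring.valuation_le_one_iff] at h1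
    exact hO.one_lt_valuation_x.not_ge h1

/-- The elements of `p`-power order of `Aut⁰(C_R)` are translations. -/
lemma exists_isTranslation_of_pow_eq_one (hh : 1 ≤ h) (hσ : σ ∈ R.Aut0) {n : ℕ}
    (hn : σ ^ p ^ n = 1) : ∃ c β, R.IsTranslation σ c β := by
  have : CharP k p := charP_of_injective_algebraMap (algebraMap (ZMod p) k).injective p
  obtain ⟨O, hO⟩ := R.exists_isAtInfinity
  rw [mem_Aut0_iff hh hO] at hσ
  obtain ⟨a, b, hx⟩ := hO.exists_apply_x_eq hh hσ
  obtain ⟨d, B, hy⟩ := hO.exists_apply_y_eq hh hσ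
  have hn' : pullback σ ^ p ^ n = 1 := by
    rw [pullback, ← MulOpposite.unop_pow, hn, MulOpposite.unop_one]
  obtain ⟨ha, hd⟩ := pow_eq_one_of_pow_eq_one hx hy hn'
  -- In characteristic p the only root of unity of p-power order is 1, so both multipliers of σ are
  -- trivial.
  have hroot : ∀ z : k, z ^ p ^ n = 1 → z = 1 := fun z hz => by
    have h1 : (z - 1) ^ p ^ n = 0 := by rw [sub_pow_char_pow, hz, one_pow, sub_self]
    exact sub_eq_zero.1 (pow_eq_zero_iff (pow_pos (Fact.out : p.Prime).pos n).ne' |>.1 h1)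
  obtain rfl := hroot a ha
  obtain rfl := hroot d hd
  rw [map_one, one_mul] at hx hy
  -- Apply σ to the curve equation and subtract the original. The constant term is then split off as
  -- β = B(0); solvability of the remaining equation forces b ∈ W.
  have hB : B ^ p - B = C b * R.toPoly + C (R.toPoly.eval b) * X +
      C (b * R.toPoly.eval b) := by
    refine R.aeval_x_injective ?_
    have hc : aeval (R.x + algebraMap k _ b) R.toPoly =
        aeval R.x (R.toPoly.comp (X + C b)) := by simp [aeval_comp]
    have h1 := congrArg (pullback σ) R.y_pow_sub
    rw [map_sub, map_pow, map_mul, ← aeval_algHom_apply (pullback σ), hx, hy, add_pow_char, hc,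
      R.toPoly_comp_X_add_C] at h1
    simp only [map_add, map_sub, map_mul, map_pow, aeval_C, aeval_X] at h1 ⊢
    linear_combination h1 - R.y_pow_sub
  have hβ : B.eval 0 ^ p - B.eval 0 = b * R.toPoly.eval b := by
    simpa [R.toPoly_eval_zero] using congrArg (eval 0) hB
  have hB' : (B - C (B.eval 0)) ^ p - (B - C (B.eval 0)) =
      C b * R.toPoly + C (R.toPoly.eval b) * X := by
    have h1 := congrArg C hβ
    rw [C_sub, C_pow] at h1
    rw [sub_pow_char]
    linear_combination hB - h1
  have hb := E_eval_eq_zero_of_pow_sub_self hB'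
  have hBb : R.B b = B - C (B.eval 0) := (R.isB_B hb).unique
    ⟨X_dvd_iff.2 (by rw [coeff_zero_eq_eval_zero]; simp), hB'⟩
  refine ⟨⟨b, hb⟩, B.eval 0, hx, ?_⟩
  rw [hy, hBb, map_sub, aeval_C]
  ring

end Translations

/-! ### The Sylow subgroup -/

section Sylow

/-- The subgroup of translations. -/
def translations (R : AdditivePoly p k h) : Subgroup R.Aut0 where
  carrier := {σ | ∃ c β, R.IsTranslation σ.1 c β}
  one_mem' := ⟨0, 0, R.isTranslation_one⟩
  mul_mem' := by
    rintro σ τ ⟨c, β, hσ⟩ ⟨d, γ, hτ⟩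
    exact ⟨_, _, hσ.mul hτ⟩
  inv_mem' := by
    rintro σ ⟨c, β, hσ⟩
    have h1 : σ⁻¹ = σ ^ (p - 1) := by
      rw [inv_eq_iff_mul_eq_one, ← pow_succ', Nat.sub_add_cancel (Fact.out : p.Prime).one_le]
      exact Subtype.ext hσ.pow_prime
    rw [h1]
    exact ⟨_, _, hσ.pow (p - 1)⟩

/-- The translations form a p-group containing every element of p-power order, so any Sylow subgroup
lies in them and equals them by maximality. -/
lemma sylow_eq_translations {R : AdditivePoly p k h} (hh : 1 ≤ h) (P : Sylow p R.Aut0) :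
    (P : Subgroup R.Aut0) = R.translations := by
  refine (P.is_maximal' ?_ ?_).symm
  · rintro ⟨σ, c, β, hσ⟩
    exact ⟨1, Subtype.ext (Subtype.ext (by rw [pow_one]; exact hσ.pow_prime))⟩
  · intro σ hσ
    obtain ⟨n, hn⟩ := P.isPGroup' ⟨σ, hσ⟩
    exact exists_isTranslation_of_pow_eq_one hh σ.2 (n := n)
      (congrArg (fun τ : P => τ.1.1) hn)

end Sylow

end AdditivePoly

namespace AdditivePoly

variable {p : ℕ} {k : Type*} [Field k] {h : ℕ}
variable [Fact p.Prime] [Fact (p ≠ 2)] [Algebra (ZMod p) k]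

/-! ### The extension of `W` by the centre: commutators, kernel and generation -/

section Sylow

variable {R : AdditivePoly p k h} {P : Sylow p R.Aut0}

lemma exists_isTranslation_of_mem_sylow (hh : 1 ≤ h) (σ : P) :
    ∃ c β, R.IsTranslation σ.1.1 c β := by
  have h1 : σ.1 ∈ (P : Subgroup R.Aut0) := σ.2
  rwa [sylow_eq_translations hh P] at h1

/-- The projection `P → W` which sends `(x, y) ↦ (x + c, …)` to `c`. -/
noncomputable def sylowToW (hh : 1 ≤ h) (P : Sylow p R.Aut0) : P →* Multiplicative R.W :=
  MonoidHom.mk' (fun σ => Multiplicative.ofAdd (exists_isTranslation_of_mem_sylow hh σ).choose)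
    fun σ τ => by
      obtain ⟨β, hβ⟩ := (exists_isTranslation_of_mem_sylow hh σ).choose_spec
      obtain ⟨γ, hγ⟩ := (exists_isTranslation_of_mem_sylow hh τ).choose_spec
      obtain ⟨δ, hδ⟩ := (exists_isTranslation_of_mem_sylow hh (σ * τ)).choose_spec
      rw [← ofAdd_add]
      exact congrArg Multiplicative.ofAdd (hδ.unique (hβ.mul hγ)).1

lemma exists_isTranslation_sylowToW (hh : 1 ≤ h) (σ : P) :
    ∃ β, R.IsTranslation σ.1.1 (sylowToW hh P σ).toAdd β :=
  (exists_isTranslation_of_mem_sylow hh σ).choose_spec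

lemma sylowToW_eq (hh : 1 ≤ h) {σ : P} {c : R.W} {β : k} (hσ : R.IsTranslation σ.1.1 c β) :
    sylowToW hh P σ = Multiplicative.ofAdd c := by
  obtain ⟨γ, hγ⟩ := exists_isTranslation_sylowToW hh σ
  exact congrArg Multiplicative.ofAdd (hγ.unique hσ).1

lemma IsTranslation.exists_sylow (hh : 1 ≤ h) (P : Sylow p R.Aut0) {σ : R.CurveAut} {c : R.W}
    {β : k} (hσ : R.IsTranslation σ c β) : ∃ τ : P, τ.1.1 = σ := by
  have hmem : (⟨σ, hσ.mem_Aut0 hh⟩ : R.Aut0) ∈ (P : Subgroup R.Aut0) := by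
    rw [sylow_eq_translations hh P]
    exact ⟨c, β, hσ⟩
  exact ⟨⟨_, hmem⟩, rfl⟩

lemma sylowToW_surjective [IsAlgClosed k] (hh : 1 ≤ h) (P : Sylow p R.Aut0) :
    Function.Surjective (sylowToW hh P) := by
  intro c
  obtain ⟨β, hβ⟩ : ∃ β : k, β ^ p - β = c.toAdd * R.toPoly.eval (c.toAdd : k) := by
    have hp := (Fact.out : p.Prime).one_lt
    set γ : k := c.toAdd * R.toPoly.eval (c.toAdd : k)
    obtain ⟨β, hβ⟩ := IsAlgClosed.exists_root (X ^ p - (X + C γ)) (by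
      rw [degree_sub_eq_left_of_degree_lt, degree_X_pow]
      · exact_mod_cast (zero_lt_one.trans hp).ne'
      · rw [degree_X_add_C, degree_X_pow]
        exact_mod_cast hp)
    refine ⟨β, ?_⟩
    simp only [IsRoot.def, eval_sub, eval_add, eval_pow, eval_X, eval_C] at hβ
    linear_combination hβ
  obtain ⟨σ, hσ⟩ := R.exists_isTranslation c.toAdd hβ
  obtain ⟨τ, rfl⟩ := hσ.exists_sylow hh P
  exact ⟨τ, sylowToW_eq hh hσ⟩

lemma sylow_ext {σ τ : P} {c : R.W} {β : k} (hσ : R.IsTranslation σ.1.1 c β)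
    (hτ : R.IsTranslation τ.1.1 c β) : σ = τ :=
  Subtype.ext (Subtype.ext (hσ.ext hτ))

lemma sylow_pow_eq_one (hh : 1 ≤ h) (σ : P) : σ ^ p = 1 := by
  obtain ⟨c, β, hσ⟩ := exists_isTranslation_of_mem_sylow hh σ
  exact Subtype.ext (Subtype.ext hσ.pow_prime)

/-- Comparing constants in [σ, τ]τσ = στ avoids inverses: the terms β + γ cancel and the difference
of the cocycles B_c(d) and B_d(c) remains. -/
lemma isTranslation_commutator (hh : 1 ≤ h) (σ τ : P) :
    R.IsTranslation ⁅σ, τ⁆.1.1 0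
      (algebraMap (ZMod p) k (R.pairing (sylowToW hh P σ).toAdd (sylowToW hh P τ).toAdd)) := by
  obtain ⟨β, hσ⟩ := exists_isTranslation_sylowToW hh σ
  obtain ⟨γ, hτ⟩ := exists_isTranslation_sylowToW hh τ
  obtain ⟨c, δ, hc⟩ := exists_isTranslation_of_mem_sylow hh ⁅σ, τ⁆
  have h1 : ⁅σ, τ⁆ * (τ * σ) = σ * τ := by rw [commutatorElement_def]; group
  have h2 := hc.mul (hτ.mul hσ)
  have h3 : (⁅σ, τ⁆ : P).1.1 * (τ.1.1 * σ.1.1) = σ.1.1 * τ.1.1 :=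
    congrArg (fun ρ : P => ρ.1.1) h1
  rw [h3] at h2
  obtain ⟨hc0, hδ⟩ := h2.unique (hσ.mul hτ)
  obtain rfl : c = 0 := by
    rw [add_comm (sylowToW hh P τ).toAdd] at hc0
    exact add_eq_right.1 hc0
  rw [Submodule.coe_zero, B_zero, eval_zero, add_zero] at hδ
  rw [algebraMap_pairing]
  have : δ = (R.B (sylowToW hh P σ).toAdd).eval ((sylowToW hh P τ).toAdd : k) -
      (R.B (sylowToW hh P τ).toAdd).eval ((sylowToW hh P σ).toAdd : k) := by
    linear_combination hδ
  rwa [← this]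

lemma commute_of_pairing_eq_zero (hh : 1 ≤ h) {σ τ : P}
    (h0 : R.pairing (sylowToW hh P σ).toAdd (sylowToW hh P τ).toAdd = 0) : Commute σ τ := by
  rw [← commutatorElement_eq_one_iff_commute]
  have h1 := isTranslation_commutator hh σ τ
  rw [h0, map_zero] at h1
  exact sylow_ext h1 R.isTranslation_one

/-- Elements over 0 commute with everything because ε(0, ·) = 0. A central element lies over a
vector orthogonal to all of W, by surjectivity, and nondegeneracy makes it 0. -/
lemma sylowToW_ker [IsAlgClosed k] (hh : 1 ≤ h) (P : Sylow p R.Aut0) :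
    (sylowToW hh P).ker = Subgroup.center P := by
  ext σ
  rw [MonoidHom.mem_ker, Subgroup.mem_center_iff]
  constructor
  · intro hσ τ
    refine commute_of_pairing_eq_zero hh ?_
    rw [hσ, toAdd_one, map_zero]
  · intro hσ
    have h1 : (sylowToW hh P σ).toAdd = 0 := by
      refine R.pairing_separatingLeft hh _ fun d => ?_
      obtain ⟨τ, hτ⟩ := sylowToW_surjective hh P (Multiplicative.ofAdd d)
      have h2 := isTranslation_commutator hh σ τ
      rw [commutatorElement_eq_one_iff_commute.2 (hσ τ).symm, hτ, toAdd_ofAdd] at h2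
      have h3 := (h2.unique R.isTranslation_one).2
      exact (algebraMap (ZMod p) k).injective (by rw [h3, map_zero])
    exact toAdd_eq_zero.1 h1

/-- The kernel of `P → W` is generated by `(x, y) ↦ (x, y + 1)`. -/
lemma sylowToW_ker_eq_zpowers (hh : 1 ≤ h) {ζ : P} (hζ : R.IsTranslation ζ.1.1 0 1) :
    (sylowToW hh P).ker = Subgroup.zpowers ζ := by
  refine le_antisymm (fun σ hσ => ?_) ?_
  · obtain ⟨β, hβ⟩ := exists_isTranslation_sylowToW hh σ
    rw [MonoidHom.mem_ker.1 hσ, toAdd_one] at hβ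
    obtain ⟨n, hn⟩ := (bot_le : (⊥ : Subfield k) ≤ (algebraMap (ZMod p) k).fieldRange) <|
      have : CharP k p := charP_of_injective_algebraMap (algebraMap (ZMod p) k).injective p
      (Subfield.mem_bot_iff_pow_eq_self k p).2 hβ.pow_eq_self_of_zero
    refine ⟨n.val, ?_⟩
    have h1 := hζ.pow n.val
    have h2 : (n.val : k) = β := by
      rw [← hn, ← map_natCast (algebraMap (ZMod p) k), ZMod.natCast_zmod_val]
    rw [smul_zero, Submodule.coe_zero, B_zero, eval_zero, mul_zero, mul_one, add_zero, h2] at h1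
    change ζ ^ (n.val : ℤ) = σ
    rw [zpow_natCast]
    exact sylow_ext h1 hβ
  · rw [Subgroup.zpowers_le, MonoidHom.mem_ker, sylowToW_eq hh hζ, ofAdd_zero]

lemma iSup_closure_eq_top (hh : 1 ≤ h) {ι : Type*} [Nonempty ι]
    (b : Module.Basis (ι ⊕ ι) (ZMod p) R.W) {s s' : ι → P}
    (hs : ∀ i, sylowToW hh P (s i) = Multiplicative.ofAdd (b (.inl i)))
    (hs' : ∀ i, sylowToW hh P (s' i) = Multiplicative.ofAdd (b (.inr i)))
    {ζ : P} (hζ : R.IsTranslation ζ.1.1 0 1) (hss' : ∀ i, ⁅s i, s' i⁆ = ζ) :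
    ⨆ i, Subgroup.closure {s i, s' i} = ⊤ := by
  set S := ⨆ i, Subgroup.closure {s i, s' i}
  have hmem : ∀ i, s i ∈ S ∧ s' i ∈ S := fun i =>
    have hi : Subgroup.closure {s i, s' i} ≤ S := le_iSup (fun i => Subgroup.closure {s i, s' i}) i
    ⟨hi (Subgroup.subset_closure (by simp)), hi (Subgroup.subset_closure (by simp))⟩
  have hker : (sylowToW hh P).ker ≤ S := by
    rw [sylowToW_ker_eq_zpowers hh hζ, Subgroup.zpowers_le, ← hss' (Classical.arbitrary ι),
      commutatorElement_def]
    obtain ⟨h1, h2⟩ := hmem (Classical.arbitrary ι)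
    exact mul_mem (mul_mem (mul_mem h1 h2) (inv_mem h1)) (inv_mem h2)
  -- A subgroup of an 𝔽_p-space is a subspace, so the image of `S`, which contains a basis, is all
  -- of W. Since `S` also contains the kernel, it is everything.
  let N : Submodule (ZMod p) R.W :=
    AddSubgroup.toZModSubmodule p (Subgroup.toAddSubgroup' (S.map (sylowToW hh P)))
  have hN : N = ⊤ := by
    rw [eq_top_iff, ← b.span_eq, Submodule.span_le]
    rintro _ ⟨i | i, rfl⟩
    · exact ⟨s i, (hmem i).1, hs i⟩
    · exact ⟨s' i, (hmem i).2, hs' i⟩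
  rw [eq_top_iff]
  intro σ _
  obtain ⟨τ, hτ, hτσ⟩ : (sylowToW hh P σ).toAdd ∈ N := hN ▸ Submodule.mem_top
  have h1 : τ⁻¹ * σ ∈ (sylowToW hh P).ker := by
    rw [MonoidHom.mem_ker, map_mul, map_inv, inv_mul_eq_one]
    exact hτσ
  have := mul_mem hτ (hker h1)
  rwa [mul_inv_cancel_left] at this

/-- Lifts to `P` of a symplectic basis of `W` decompose `P` into a central product. -/
lemma centralProduct_of_isSymplecticBasis [IsAlgClosed k] (hh : 1 ≤ h) {ι : Type*} [Fintype ι]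
    [DecidableEq ι] [Nonempty ι] {b : Module.Basis (ι ⊕ ι) (ZMod p) R.W}
    (hb : IsSymplecticBasis R.pairing b) {s s' : ι → P}
    (hs : ∀ i, sylowToW hh P (s i) = Multiplicative.ofAdd (b (.inl i)))
    (hs' : ∀ i, sylowToW hh P (s' i) = Multiplicative.ofAdd (b (.inr i))) :
    (Nat.card (ExtraspecialP3 p) = p ^ 3 ∧ Monoid.exponent (ExtraspecialP3 p) = p ∧
      ¬ Commute (ExtraspecialP3.u p) (ExtraspecialP3.v p)) ∧
    IsCentralProduct (fun i => Subgroup.closure {s i, s' i}) ∧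
      (∀ i, Nonempty (Subgroup.closure {s i, s' i} ≃* ExtraspecialP3 p)) ∧
      ∃ Φ : CentralPower ι (ExtraspecialP3 p) ≃* P, ∀ i,
        Φ (CentralPower.single i (ExtraspecialP3.u p)) = s i ∧
        Φ (CentralPower.single i (ExtraspecialP3.v p)) = s' i := by
  -- The normalization ε(c_i, c'_i) = 1 makes the commutators of all the pairs the same element (x,
  -- y) ↦ (x, y + 1); this is what identifies the centres of the factors.
  have hcomm : ∀ i, R.IsTranslation ⁅s i, s' i⁆.1.1 0 1 := fun i => by
    have h1 := isTranslation_commutator hh (s i) (s' i)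
    rwa [hs, hs', toAdd_ofAdd, toAdd_ofAdd, (hb i i).2.2, if_pos rfl, map_one] at h1
  set i₀ := Classical.arbitrary ι
  have hss' : ∀ i, ⁅s i, s' i⁆ = ⁅s i₀, s' i₀⁆ := fun i => sylow_ext (hcomm i) (hcomm i₀)
  have hne : ⁅s i₀, s' i₀⁆ ≠ 1 := fun h0 => by
    have h1 := hcomm i₀
    rw [h0] at h1
    exact one_ne_zero (h1.unique R.isTranslation_one).2
  have hcenter : Subgroup.center P = Subgroup.zpowers ⁅s i₀, s' i₀⁆ := by
    rw [← sylowToW_ker hh P, sylowToW_ker_eq_zpowers hh (hcomm i₀)]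
  have hzc : ∀ σ, Commute ⁅s i₀, s' i₀⁆ σ := fun σ =>
    (Subgroup.mem_center_iff.1 (hcenter ▸ Subgroup.mem_zpowers _) σ).symm
  refine ⟨extraspecialP3_properties (sylow_pow_eq_one hh) hne hzc,
    exists_centralPower_mulEquiv (sylow_pow_eq_one hh) hne hcenter hss' (fun i j hij => ?_)
      (iSup_closure_eq_top hh b hs hs' (hcomm i₀) hss')⟩
  refine ⟨commute_of_pairing_eq_zero hh ?_, commute_of_pairing_eq_zero hh ?_,
    commute_of_pairing_eq_zero hh ?_⟩
  · rw [hs, hs, toAdd_ofAdd, toAdd_ofAdd, (hb i j).1]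
  · rw [hs, hs', toAdd_ofAdd, toAdd_ofAdd, (hb i j).2.2, if_neg hij]
  · rw [hs', hs', toAdd_ofAdd, toAdd_ofAdd, (hb i j).2.1]

end Sylow

end AdditivePoly

/-! ### Assembly of the main theorem -/

theorem mainTheorem6 {p : ℕ} [Fact p.Prime] [Fact (p ≠ 2)]
    {k : Type*} [Field k] [Algebra (ZMod p) k] [IsAlgClosure (ZMod p) k]
    {h : ℕ} (hh : 1 ≤ h) (R : AdditivePoly p k h) (P : Sylow p R.Aut0) :
    -- the group `E(p³)` is nonabelian of order `p³` and exponent `p`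
    (Nat.card (ExtraspecialP3 p) = p ^ 3 ∧ Monoid.exponent (ExtraspecialP3 p) = p ∧
      ¬ Commute (ExtraspecialP3.u p) (ExtraspecialP3.v p)) ∧
    -- `P` is a central product of `h` copies of `E(p³)`
    Nonempty (P ≃* CentralPower (Fin h) (ExtraspecialP3 p)) ∧
    -- the polynomials `B_c` in the definition of the pairing are well defined
    (∀ c ∈ R.W, ∃! B : k[X], R.IsB c B) ∧
    ∃ (π : P →* Multiplicative R.W) (ε : LinearMap.BilinForm (ZMod p) R.W),
      -- `π : P → W` sends `(x, y) ↦ (x + c, …)` to `c`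
      (∀ σ : P, AdditivePoly.pullback σ.1.1 R.x =
        R.x + algebraMap k R.FunctionField (π σ).toAdd) ∧
      Function.Surjective π ∧ π.ker = Subgroup.center P ∧
      -- `ε(c₁, c₂) = B_{c₁}(c₂) - B_{c₂}(c₁)` is a nondegenerate symplectic pairing
      (∀ c₁ c₂ : R.W, algebraMap (ZMod p) k (ε c₁ c₂) =
        (R.B c₁).eval (c₂ : k) - (R.B c₂).eval (c₁ : k)) ∧
      ε.IsAlt ∧ ε.Nondegenerate ∧
      -- it is the commutator pairing: `[σ, τ]` is `(x, y) ↦ (x, y + ε(π σ, π τ))`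
      (∀ σ τ : P,
        AdditivePoly.pullback ⁅σ, τ⁆.1.1 R.x = R.x ∧
        AdditivePoly.pullback ⁅σ, τ⁆.1.1 R.y = R.y +
          algebraMap k R.FunctionField
            (algebraMap (ZMod p) k (ε (π σ).toAdd (π τ).toAdd))) ∧
      -- symplectic bases exist, and lifts to `P` of any of them give the decomposition
      (∃ b : Module.Basis (Fin h ⊕ Fin h) (ZMod p) R.W, IsSymplecticBasis ε b) ∧
      ∀ b : Module.Basis (Fin h ⊕ Fin h) (ZMod p) R.W, IsSymplecticBasis ε b →
        ∀ s s' : Fin h → P,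
          (∀ i, π (s i) = Multiplicative.ofAdd (b (.inl i))) →
          (∀ i, π (s' i) = Multiplicative.ofAdd (b (.inr i))) →
          IsCentralProduct (fun i => Subgroup.closure {s i, s' i}) ∧
          (∀ i, Nonempty (Subgroup.closure {s i, s' i} ≃* ExtraspecialP3 p)) ∧
          ∃ Φ : CentralPower (Fin h) (ExtraspecialP3 p) ≃* P, ∀ i,
            Φ (CentralPower.single i (ExtraspecialP3.u p)) = s i ∧
            Φ (CentralPower.single i (ExtraspecialP3.v p)) = s' i := by
  have : IsAlgClosed k := IsAlgClosure.isAlgClosed (ZMod p)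
  have : CharP k p := charP_of_injective_algebraMap (algebraMap (ZMod p) k).injective p
  have : Nonempty (Fin h) := ⟨⟨0, hh⟩⟩
  have : Finite R.W := Nat.finite_of_card_ne_zero
    (by rw [R.card_W hh]; exact (pow_pos (Fact.out : p.Prime).pos _).ne')
  have hsurj := AdditivePoly.sylowToW_surjective hh P
  obtain ⟨b, hb⟩ := exists_isSymplecticBasis R.pairing_isAlt (R.pairing_nondegenerate hh)
    (R.finrank_W hh)
  choose s hs using fun i => hsurj (Multiplicative.ofAdd (b (.inl i)))
  choose s' hs' using fun i => hsurj (Multiplicative.ofAdd (b (.inr i)))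
  obtain ⟨hE, -, -, Φ, -⟩ := AdditivePoly.centralProduct_of_isSymplecticBasis hh hb hs hs'
  refine ⟨hE, ⟨Φ.symm⟩, fun c hc => ⟨_, R.isB_explicitB hc, fun B hB =>
    hB.unique (R.isB_explicitB hc)⟩, AdditivePoly.sylowToW hh P, R.pairing, fun σ => ?_, hsurj,
    AdditivePoly.sylowToW_ker hh P, R.algebraMap_pairing, R.pairing_isAlt,
    R.pairing_nondegenerate hh, fun σ τ => ?_, ⟨b, hb⟩, fun b hb s s' hs hs' =>
      (AdditivePoly.centralProduct_of_isSymplecticBasis hh hb hs hs').2⟩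
  · obtain ⟨β, hβ⟩ := AdditivePoly.exists_isTranslation_sylowToW hh σ
    exact hβ.apply_x
  · have h1 := AdditivePoly.isTranslation_commutator hh σ τ
    exact ⟨by simpa using h1.apply_x, by simpa [AdditivePoly.B_zero] using h1.apply_y⟩
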